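/- Let $m_1,m_2\ge 1$ be integers, $l=m_1+m_2$, and let $e_{i,j}$ denote the $l\times l$ elementary matrices. For $a=1,\dots,l-1$ put $q_a=\frac{a}{m_1}$ and $K_a=\sum_{j=1}^{a}e_{j,m_1-a+j}$ if $a\le m_1$, and $q_a=\frac{l-a}{m_2}$ and $K_a=-\sum_{j=1}^{l-a}e_{a+j,m_1+j}$ if $a>m_1$. Let $$W(z,s)=\Bigl(z-\frac12\Bigr)e_{1,m_1}-s\,e_{1,l}+s\sum_{i=2}^{l}e_{i,i-1}.$$ Define the generalized Bernoulli polynomials $B_m(\ell,x)$ by $\bigl(\frac{t}{e^t-1}\bigr)^{\ell}e^{xt}=\sum_{m\ge0}B_m(\ell,x)\frac{t^m}{m!}$, and let $\delta_{d\mid n}$ be $1$ if $d\mid n$ and $0$ otherwise. Then for each $a=1,\dots,l-1$ there is a unique formal solution $M_a(z,s)\in z^{1-q_a}\,\mathrm{Mat}(l\times l,\mathbb{C}(s)((z^{-1})))$ of the difference equation $$M(z-1,s)\,W(z,s)=W(z,s)\,M(z,s)$$ of the form $M_a(z,s)=z^{1-q_a}\bigl(K_a+O(z^{-1})\bigr)$,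 and its entries are, for $1\le i,j\le l$, $$(M_a(z,s))_{ij}=\begin{cases} g_a(z,i,j), & j\le m_1,\\ -g_a(z,i,j-m_1-m_2), & j>m_1,\end{cases}$$ where, for $a=1,\dots,m_1$, $$g_a(z,i,j)=z^{-\frac{a}{m_1}}\sum_{\ell_1\ge-1}\frac{m_1^{\ell_1}}{z^{\ell_1}}\sum_{\ell_2=-1}^{\ell_1}\delta_{m_2\mid(m_1\ell_2+a+j-i)}\frac{s^{\frac{l\ell_2+a+j-i}{m_2}+1}}{m_1^{\ell_2}m_2^{\frac{m_1\ell_2+a+j-i}{m_2}}}\sum_{\ell_3=0}^{\frac{m_1\ell_2+a+j-i}{m_2}}\frac{(-1)^{\ell_3}\binom{-\ell_2-\frac{a}{m_1}}{\ell_1-\ell_2}}{\ell_3!\,\bigl(\frac{m_1\ell_2+a+j-i}{m_2}-\ell_3\bigr)!}\,B_{\ell_1-\ell_2}\Bigl(1-\ell_2-\frac{a}{m_1},\frac{i-\frac12-a+m_2\ell_3}{m_1}-\ell_2\Bigr),$$ and, for $a=m_1+1,\dots,l-1$, $$g_a(z,i,j)=z^{-\frac{l-a}{m_2}}\sum_{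\ell_1\ge-1}\frac{m_2^{\ell_1}}{z^{\ell_1}}\sum_{\ell_2=-1}^{\ell_1}\delta_{m_1\mid(m_2\ell_2+i-j-a)}\frac{s^{\frac{l\ell_2+i-j-a}{m_1}+1}}{m_1^{\frac{m_2\ell_2+i-j-a}{m_1}}m_2^{\ell_2}}\sum_{\ell_3=0}^{\frac{m_2\ell_2+i-j-a}{m_1}}\frac{(-1)^{\ell_3}\binom{-\ell_2-\frac{l-a}{m_2}}{\ell_1-\ell_2}}{\ell_3!\,\bigl(\frac{m_2\ell_2+i-j-a}{m_1}-\ell_3\bigr)!}\,B_{\ell_1-\ell_2}\Bigl(1-\ell_2-\frac{l-a}{m_2},\frac{j-\frac12+a-m_1+m_1\ell_3}{m_2}-\ell_2\Bigr).$$ (A sum whose upper limit is negative is zero.) -/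

import Mathlib

noncomputable section

namespace TDE

/-! ### Generalized Bernoulli polynomials -/

/-- For a power series `f` with constant coefficient `1` and `r ∈ ℚ`, the power series
`f ^ r = ∑ k, binom(r, k) (f - 1) ^ k`. -/
def powRat (f : PowerSeries ℚ) (r : ℚ) : PowerSeries ℚ :=
  (PowerSeries.binomialSeries ℚ r).subst (f - 1)

/-- The generalized Bernoulli polynomial `B_m(ℓ, x)`, for rational `ℓ` and `x`:
`(t / (e^t - 1)) ^ ℓ * e^(x t) = ∑ m, B_m(ℓ, x) t^m / m!`.
Here `bernoulliPowerSeries ℚ` is the power series `t / (e^t - 1)`, see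
`bernoulliPowerSeries_mul_exp_sub_one`. -/
def genBernoulli (m : ℕ) (ℓ x : ℚ) : ℚ :=
  (m.factorial : ℚ) * PowerSeries.coeff m
    (powRat (bernoulliPowerSeries ℚ) ℓ * PowerSeries.rescale x (PowerSeries.exp ℚ))

/-! ### Formal series in rational powers of `z⁻¹` -/

/-- The field of rational functions `ℂ(s)`. -/
abbrev Coef : Type := RatFunc ℂ

/-- Formal series in rational powers of `z⁻¹` with coefficients in `ℂ(s)` (and with well-ordered
support in the exponents of `z⁻¹`). The coefficient at `r` is the coefficient of `z ^ (-r)`. -/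
abbrev Ser : Type := HahnSeries ℚ Coef

/-- The monomial `z ^ r`. -/
def zPow (r : ℚ) : Ser := HahnSeries.single (-r) 1

/-- The inclusion of `ℂ(s)((z⁻¹))` into the formal series in rational powers of `z⁻¹`. The
coefficient at `n` of a Laurent series is the coefficient of `z ^ (-n)`. -/
def ofLaurent : LaurentSeries Coef →+* Ser :=
  HahnSeries.embDomainRingHom (Int.castAddHom ℚ) Int.cast_injective (fun _ _ => Int.cast_le)

/-- The support of the shifted series is partially well-ordered, so that the operator `shift`
below is well defined. -/
theorem shift_isPWO (f : Ser) :
    (Function.support fun r : ℚ => ∑ᶠ k : ℕ,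
      (((-1) ^ k * Ring.choose (-(r - k)) k : ℚ) : Coef) * f.coeff (r - k)).IsPWO := by
  have hN : (Set.range (Nat.cast : ℕ → ℚ)).IsPWO := by
    rw [← Set.image_univ]
    exact (Set.isPWO_of_wellQuasiOrderedLE Set.univ).image_of_monotone Nat.mono_cast
  refine (f.isPWO_support.add hN).mono ?_
  intro r hr
  obtain ⟨k, hk⟩ : ∃ k : ℕ,
      (((-1) ^ k * Ring.choose (-(r - k)) k : ℚ) : Coef) * f.coeff (r - k) ≠ 0 := by
    by_contra! h
    exact hr (by simp only [h, finsum_zero])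
  exact ⟨r - k, fun h => hk (by rw [h, mul_zero]), k, ⟨k, rfl⟩, by simp⟩

/-- The sums over `k` in the definition of `shift` below have finitely many nonzero terms. -/
theorem shift_finite (f : Ser) (r : ℚ) :
    (Function.support fun k : ℕ =>
      (((-1) ^ k * Ring.choose (-(r - k)) k : ℚ) : Coef) * f.coeff (r - k)).Finite := by
  have h : {k : ℕ | r - (k : ℚ) ∈ f.support}.Finite := by
    by_contra hinf
    have hinf : {k : ℕ | r - (k : ℚ) ∈ f.support}.Infinite := hinf
    have hP := f.isPWO_support
    obtain ⟨m, n, hmn, hle⟩ := hP (fun n => ⟨r - (Nat.nth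
      (fun k : ℕ => r - (k : ℚ) ∈ f.support) n : ℚ), Nat.nth_mem_of_infinite hinf n⟩)
    have h1 := Nat.nth_strictMono hinf hmn
    have h2 : (Nat.nth (fun k : ℕ => r - (k : ℚ) ∈ f.support) m : ℚ) <
      Nat.nth (fun k : ℕ => r - (k : ℚ) ∈ f.support) n := by exact_mod_cast h1
    have h3 : r - (Nat.nth (fun k : ℕ => r - (k : ℚ) ∈ f.support) m : ℚ) ≤
      r - Nat.nth (fun k : ℕ => r - (k : ℚ) ∈ f.support) n := hle
    linarith
  exact h.subset fun k hk => fun h0 => hk (by simp only [h0, mul_zero])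

/-- The substitution `f(z) ↦ f(z - 1)`, where
`(z - 1) ^ (-p) = ∑ k ≥ 0, binom(-p, k) (-1)^k z^(-p-k)`.
The coefficient of `z ^ (-r)` collects the contributions of the terms with `p = r - k`. -/
def shift (f : Ser) : Ser where
  coeff r := ∑ᶠ k : ℕ, (((-1) ^ k * Ring.choose (-(r - k)) k : ℚ) : Coef) * f.coeff (r - k)
  isPWO_support' := shift_isPWO f

/-! ### The topological difference equation of `(m₁, m₂)`-type -/

/-- The `l × l` elementary matrix `e_{p,q}`, whose rows and columns are numbered `1, …, l`. -/
def elem {R : Type} [Zero R] [One R] (l p q : ℕ) : Matrix (Fin l) (Fin l) R :=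
  Matrix.of fun i j => if (i : ℕ) + 1 = p ∧ (j : ℕ) + 1 = q then 1 else 0

/-- `q_a = a / m₁` for `a ≤ m₁`, and `q_a = (l - a) / m₂` for `a > m₁`. -/
def q (m₁ m₂ a : ℕ) : ℚ :=
  if a ≤ m₁ then (a : ℚ) / m₁ else ((m₁ : ℚ) + m₂ - a) / m₂

/-- The element `s` of `ℂ(s)`. -/
def s : Coef := RatFunc.X

/-- `W(z, s) = (z - 1/2) e_{1,m₁} - s e_{1,l} + s ∑_{i=2}^l e_{i,i-1}`. -/
def W (m₁ m₂ : ℕ) : Matrix (Fin (m₁ + m₂)) (Fin (m₁ + m₂)) Ser :=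
  (zPow 1 - HahnSeries.C (1 / 2)) • elem (m₁ + m₂) 1 m₁
    - (HahnSeries.C s : Ser) • elem (m₁ + m₂) 1 (m₁ + m₂)
    + (HahnSeries.C s : Ser) • ∑ i ∈ Finset.Icc 2 (m₁ + m₂), elem (m₁ + m₂) i (i - 1)

/-- `K_a = ∑_{j=1}^a e_{j,m₁-a+j}` for `a ≤ m₁`, and `K_a = -∑_{j=1}^{l-a} e_{a+j,m₁+j}` for
`a > m₁`. -/
def K (m₁ m₂ a : ℕ) : Matrix (Fin (m₁ + m₂)) (Fin (m₁ + m₂)) Coef :=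
  if a ≤ m₁ then ∑ j ∈ Finset.Icc 1 a, elem (m₁ + m₂) j (m₁ - a + j)
  else -∑ j ∈ Finset.Icc 1 (m₁ + m₂ - a), elem (m₁ + m₂) (a + j) (m₁ + j)

/-- `M` is a formal solution in `z^(1-q_a) Mat(l × l, ℂ(s)((z⁻¹)))` of the topological difference
equation `M(z-1, s) W(z, s) = W(z, s) M(z, s)`, of the form `M = z^(1-q_a) (K_a + O(z⁻¹))`. -/
structure IsSolution (m₁ m₂ a : ℕ) (M : Matrix (Fin (m₁ + m₂)) (Fin (m₁ + m₂)) Ser) : Prop where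
  equation : M.map shift * W m₁ m₂ = W m₁ m₂ * M
  form : ∃ N : Matrix (Fin (m₁ + m₂)) (Fin (m₁ + m₂)) (LaurentSeries Coef),
    M = zPow (1 - q m₁ m₂ a) • N.map ofLaurent ∧
    ∀ i j, ∀ n : ℤ, n ≤ 0 → (N i j).coeff n = if n = 0 then K m₁ m₂ a i j else 0

/-! ### The explicit series -/

/-- The coefficient of `z ^ (-a/m₁ - ℓ₁)` in `g_a(z, i, j)`, for `1 ≤ a ≤ m₁`. -/
def gCoeffLow (m₁ m₂ a : ℕ) (i j ℓ₁ : ℤ) : Coef :=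
  (m₁ : Coef) ^ ℓ₁ * ∑ ℓ₂ ∈ Finset.Icc (-1) ℓ₁,
    if (m₂ : ℤ) ∣ m₁ * ℓ₂ + a + j - i then
      s ^ (((m₁ + m₂ : ℤ) * ℓ₂ + a + j - i) / m₂ + 1) /
          ((m₁ : Coef) ^ ℓ₂ * (m₂ : Coef) ^ ((m₁ * ℓ₂ + a + j - i) / m₂)) *
        ((∑ ℓ₃ ∈ Finset.Icc 0 ((m₁ * ℓ₂ + a + j - i) / m₂),
          (-1) ^ ℓ₃.toNat * Ring.choose (-(ℓ₂ : ℚ) - a / m₁) (ℓ₁ - ℓ₂).toNat /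
              ((ℓ₃.toNat.factorial : ℚ) *
                (((m₁ * ℓ₂ + a + j - i) / m₂ - ℓ₃).toNat.factorial : ℚ)) *
            genBernoulli (ℓ₁ - ℓ₂).toNat (1 - ℓ₂ - a / m₁)
              (((i : ℚ) - 1 / 2 - a + m₂ * ℓ₃) / m₁ - ℓ₂) : ℚ) : Coef)
    else 0

/-- The coefficient of `z ^ (-(l-a)/m₂ - ℓ₁)` in `g_a(z, i, j)`, for `m₁ < a ≤ l - 1`. -/
def gCoeffHigh (m₁ m₂ a : ℕ) (i j ℓ₁ : ℤ) : Coef :=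
  (m₂ : Coef) ^ ℓ₁ * ∑ ℓ₂ ∈ Finset.Icc (-1) ℓ₁,
    if (m₁ : ℤ) ∣ m₂ * ℓ₂ + i - j - a then
      s ^ (((m₁ + m₂ : ℤ) * ℓ₂ + i - j - a) / m₁ + 1) /
          ((m₁ : Coef) ^ ((m₂ * ℓ₂ + i - j - a) / m₁) * (m₂ : Coef) ^ ℓ₂) *
        ((∑ ℓ₃ ∈ Finset.Icc 0 ((m₂ * ℓ₂ + i - j - a) / m₁),
          (-1) ^ ℓ₃.toNat *
              Ring.choose (-(ℓ₂ : ℚ) - ((m₁ : ℚ) + m₂ - a) / m₂) (ℓ₁ - ℓ₂).toNat /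
              ((ℓ₃.toNat.factorial : ℚ) *
                (((m₂ * ℓ₂ + i - j - a) / m₁ - ℓ₃).toNat.factorial : ℚ)) *
            genBernoulli (ℓ₁ - ℓ₂).toNat (1 - ℓ₂ - ((m₁ : ℚ) + m₂ - a) / m₂)
              (((j : ℚ) - 1 / 2 + a - m₁ + m₁ * ℓ₃) / m₂ - ℓ₂) : ℚ) : Coef)
    else 0

/-- The Laurent series `∑_{n ≥ -1} c(n) z ^ (-n)`. -/
def laurentFromNegOne (c : ℤ → Coef) : LaurentSeries Coef :=
  HahnSeries.ofSuppBddBelow (fun n : ℤ => if -1 ≤ n then c n else 0)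
    ⟨-1, fun n hn => by
      by_contra h
      exact hn (if_neg h)⟩

/-- The series `g_a(z, i, j) = z ^ (-q_a) ∑_{ℓ₁ ≥ -1} c(ℓ₁) z ^ (-ℓ₁)`. -/
def g (m₁ m₂ a : ℕ) (i j : ℤ) : Ser :=
  zPow (-q m₁ m₂ a) * ofLaurent (laurentFromNegOne
    (if a ≤ m₁ then gCoeffLow m₁ m₂ a i j else gCoeffHigh m₁ m₂ a i j))

end TDE

end

/-!
The difference equation is a system for the entries of `M`. If the columns `m₁ + 1, …, l` are given
the opposite sign and renumbered `1 - m₂, …, 0`, the entries become `E i j` with `1 ≤ i ≤ l` and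
`1 - m₂ ≤ j ≤ m₁`, and the system says that `E i j` is a function of `z + i` and `z + j`, i.e.
`shift (E (i + 1) (j + 1)) = E i j`, subject to the two boundary conditions obtained from the
three-term relations
`s (E i (j + m₁) + E i (j - m₂)) = (z + j - 1/2) E i j` and
`s (E (i - m₁) j + E (i + m₂) j) = (z + i - m₁ - 1/2) E i j`
by specializing to `j = 0` and to `i = m₁` (`foldMatrix_equation_iff`).

*Existence.* For fixed `ℓ₂` and `ℓ₃` the sum over `ℓ₁` in `g_a` is the asymptotic expansion of a
quotient of Gamma functions, `m ^ α Γ(z / m + x) / Γ(z / m + x - α)`. The functional equation of the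
Gamma function becomes the recursions `gammaCoeff_add_one` and `gammaCoeff_add_one_add_one` between
generalized Bernoulli polynomials, and translation in `z` becomes translation in `x`
(`sum_choose_mul_gammaCoeff`). The sum over `ℓ₃` is an iterated finite difference, and the three
relations above hold separately for each `ℓ₂` (`sum_choose_mul_term`, `term_add_left`,
`term_add_right`), once the sum over `ℓ₂` is extended to all integers; this is harmless, because the
additional terms vanish in the relevant range of `i` and `j`. The formula for `a > m₁` is the one
for `a ≤ m₁` after exchanging `m₁` and `m₂` (`gCoeffHigh_eq_gCoeffLow`), which exchanges the two
three-term relations.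

*Uniqueness.* The difference of two solutions is a solution whose entries only contain exponents
`r > 0` of `z⁻¹`. Let `ρ` be the least exponent that occurs. To leading order the boundary
conditions force the coefficients at `ρ` to vanish on the diagonals `-l < j - i ≤ 0`
(`coeff_eq_zero_of_le`). To next order, they give a linear relation between the coefficients on the
diagonals `j - i = e` and `j - i = e - l`, with factors `m₁ ρ + e` and `e - m₂ ρ`
(`coeff_relation`). One of these diagonals is among those already treated, and the factor of the
other is nonzero, so that all coefficients at `ρ` vanish, a contradiction.
-/

noncomputable section

namespace TDE

/-! ### Generalized Bernoulli polynomials -/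

open PowerSeries in
/-- `(1 + X) * d/dX (1 + X) ^ r = r * (1 + X) ^ r`. -/
theorem one_add_X_mul_derivative_binomialSeries (r : ℚ) :
    (1 + X) * derivative ℚ (PowerSeries.binomialSeries ℚ r) =
      C r * PowerSeries.binomialSeries ℚ r := by
  have key : ∀ k : ℕ, ((k : ℚ) + 1) * Ring.choose r (k + 1) = (r - k) * Ring.choose r k := by
    intro k
    have h := Ring.choose_smul_choose r (Nat.le_succ k)
    rw [Nat.succ_eq_add_one, Nat.choose_succ_self_right, Nat.add_sub_cancel_left,
      Ring.choose_one_right, nsmul_eq_mul] at h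
    push_cast at h
    linarith
  ext n
  rw [add_mul, one_mul, map_add, coeff_C_mul]
  cases n with
  | zero =>
    have := key 0
    simp only [coeff_derivative, binomialSeries_coeff, coeff_zero_X_mul, smul_eq_mul, mul_one]
    push_cast at this ⊢
    linarith
  | succ n =>
    have := key (n + 1)
    simp only [coeff_succ_X_mul, coeff_derivative, binomialSeries_coeff, smul_eq_mul, mul_one]
    push_cast at this ⊢
    linarith

theorem hasSubst_sub_one {f : PowerSeries ℚ} (hf : PowerSeries.constantCoeff f = 1) :
    PowerSeries.HasSubst (f - 1) :=
  PowerSeries.HasSubst.of_constantCoeff_zero' (by simp [hf])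

theorem powRat_add_one {f : PowerSeries ℚ} (hf : PowerSeries.constantCoeff f = 1) (r : ℚ) :
    powRat f (r + 1) = f * powRat f r := by
  have hs := hasSubst_sub_one hf
  have h1 : PowerSeries.binomialSeries ℚ (1 : ℚ) = 1 + PowerSeries.X := by
    simpa using PowerSeries.binomialSeries_nat (R := ℚ) (A := ℚ) 1
  have h2 : (1 : PowerSeries ℚ).subst (f - 1) = (1 : PowerSeries ℚ) := by
    rw [← PowerSeries.coe_substAlgHom hs, map_one]
  rw [powRat, PowerSeries.binomialSeries_add, PowerSeries.subst_mul hs, h1,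
    PowerSeries.subst_add hs, PowerSeries.subst_X hs, h2, mul_comm, powRat]
  ring

theorem mul_derivative_powRat {f : PowerSeries ℚ} (hf : PowerSeries.constantCoeff f = 1) (r : ℚ) :
    f * PowerSeries.derivative ℚ (powRat f r) =
      PowerSeries.C r * powRat f r * PowerSeries.derivative ℚ f := by
  have hs := hasSubst_sub_one hf
  have h2 : (1 : PowerSeries ℚ).subst (f - 1) = (1 : PowerSeries ℚ) := by
    rw [← PowerSeries.coe_substAlgHom hs, map_one]
  have h := congrArg (PowerSeries.subst (f - 1)) (one_add_X_mul_derivative_binomialSeries r)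
  rw [PowerSeries.subst_mul hs, PowerSeries.subst_add hs, PowerSeries.subst_X hs, h2,
    ← PowerSeries.smul_eq_C_mul, PowerSeries.subst_smul hs, add_sub_cancel] at h
  rw [powRat, PowerSeries.derivative_subst hs, map_sub, PowerSeries.derivative_one, sub_zero,
    ← mul_assoc, h, PowerSeries.smul_eq_C_mul]

theorem constantCoeff_powRat {f : PowerSeries ℚ} (hf : PowerSeries.constantCoeff f = 1) (r : ℚ) :
    PowerSeries.constantCoeff (powRat f r) = 1 := by
  have hs := hasSubst_sub_one hf
  have h : PowerSeries.binomialSeries ℚ r = (PowerSeries.binomialSeries ℚ r - 1) + 1 := by ring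
  have h2 : (1 : PowerSeries ℚ).subst (f - 1) = (1 : PowerSeries ℚ) := by
    rw [← PowerSeries.coe_substAlgHom hs, map_one]
  rw [powRat, h, PowerSeries.subst_add hs, h2, map_add, map_one,
    show PowerSeries.constantCoeff (PowerSeries.subst (f - 1)
      (PowerSeries.binomialSeries ℚ r - 1)) = 0 from
      PowerSeries.constantCoeff_subst_eq_zero (by rw [map_sub, map_one]; exact sub_eq_zero.2 hf) _
        (by rw [map_sub, map_one, PowerSeries.binomialSeries_constantCoeff, sub_self]), zero_add]

theorem constantCoeff_bernoulliPowerSeries :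
    PowerSeries.constantCoeff (bernoulliPowerSeries ℚ) = 1 := by
  rw [← PowerSeries.coeff_zero_eq_constantCoeff_apply, bernoulliPowerSeries, PowerSeries.coeff_mk]
  simp

/-- The logarithmic derivative of `f = t / (e ^ t - 1)`: `t f' = f - t f - f ^ 2`. -/
theorem X_mul_derivative_bernoulliPowerSeries :
    PowerSeries.X * PowerSeries.derivative ℚ (bernoulliPowerSeries ℚ) =
      bernoulliPowerSeries ℚ - PowerSeries.X * bernoulliPowerSeries ℚ
        - bernoulliPowerSeries ℚ * bernoulliPowerSeries ℚ := by
  have h1 := bernoulliPowerSeries_mul_exp_sub_one ℚ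
  have h2 := congrArg (PowerSeries.derivative ℚ) h1
  rw [Derivation.leibniz, map_sub, PowerSeries.derivative_one, PowerSeries.derivative_X,
    PowerSeries.derivative_exp, smul_eq_mul, smul_eq_mul, sub_zero] at h2
  linear_combination bernoulliPowerSeries ℚ * h2
    - (PowerSeries.derivative ℚ (bernoulliPowerSeries ℚ) + bernoulliPowerSeries ℚ) * h1

theorem derivative_rescale_exp (x : ℚ) :
    PowerSeries.derivative ℚ (PowerSeries.rescale x (PowerSeries.exp ℚ)) =
      PowerSeries.C x * PowerSeries.rescale x (PowerSeries.exp ℚ) := by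
  ext n
  rw [PowerSeries.coeff_derivative, PowerSeries.coeff_C_mul, PowerSeries.coeff_rescale,
    PowerSeries.coeff_rescale, PowerSeries.coeff_exp, PowerSeries.coeff_exp, Nat.factorial_succ]
  simp only [eq_ratCast, Rat.cast_id]
  push_cast
  have : (n.factorial : ℚ) ≠ 0 := by positivity
  field_simp
  ring

/-- The exponential generating series `(t / (e ^ t - 1)) ^ ℓ * e ^ (x t)` of the generalized
Bernoulli polynomials `B_m(ℓ, x)`. -/
def genBernoulliSeries (ℓ x : ℚ) : PowerSeries ℚ :=
  powRat (bernoulliPowerSeries ℚ) ℓ * PowerSeries.rescale x (PowerSeries.exp ℚ)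

theorem coeff_zero_genBernoulliSeries (ℓ x : ℚ) :
    PowerSeries.coeff 0 (genBernoulliSeries ℓ x) = 1 := by
  rw [genBernoulliSeries, PowerSeries.coeff_zero_eq_constantCoeff_apply, map_mul,
    constantCoeff_powRat constantCoeff_bernoulliPowerSeries,
    ← PowerSeries.coeff_zero_eq_constantCoeff_apply, PowerSeries.coeff_rescale]
  simp

theorem genBernoulliSeries_add (ℓ x y : ℚ) :
    genBernoulliSeries ℓ (x + y) =
      genBernoulliSeries ℓ x * PowerSeries.rescale y (PowerSeries.exp ℚ) := by
  rw [genBernoulliSeries, ← PowerSeries.exp_mul_exp_eq_exp_add, ← mul_assoc, genBernoulliSeries]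

/-- The differential equation behind the recursion in `ℓ`; the factor `f = t / (e ^ t - 1)` of the
derivative of `f ^ ℓ` is cancelled. -/
theorem X_mul_derivative_genBernoulliSeries (ℓ x : ℚ) :
    PowerSeries.X * PowerSeries.derivative ℚ (genBernoulliSeries ℓ x) =
      PowerSeries.C ℓ * genBernoulliSeries ℓ x
        + PowerSeries.C (x - ℓ) * (PowerSeries.X * genBernoulliSeries ℓ x)
        - PowerSeries.C ℓ * genBernoulliSeries (ℓ + 1) x := by
  have hc := constantCoeff_bernoulliPowerSeries
  have h0 : bernoulliPowerSeries ℚ ≠ 0 := by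
    intro h
    rw [h] at hc
    simp at hc
  have h1 := mul_derivative_powRat hc ℓ
  have h2 := X_mul_derivative_bernoulliPowerSeries
  apply mul_left_cancel₀ h0
  simp only [genBernoulliSeries, Derivation.leibniz, derivative_rescale_exp, smul_eq_mul,
    powRat_add_one hc, map_sub]
  linear_combination PowerSeries.X * PowerSeries.rescale x (PowerSeries.exp ℚ) * h1
    + PowerSeries.C ℓ * powRat (bernoulliPowerSeries ℚ) ℓ
      * PowerSeries.rescale x (PowerSeries.exp ℚ) * h2

/-- In terms of `B_k = B_k(ℓ, x)`, this is
`ℓ B_k(ℓ + 1, x) = (ℓ - k) B_k + k (x - ℓ) B_{k-1}`, shifted by one in `k`. -/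
theorem coeff_genBernoulliSeries_add_one (k : ℕ) (ℓ x : ℚ) :
    ℓ * PowerSeries.coeff (k + 1) (genBernoulliSeries (ℓ + 1) x) =
      (ℓ - (k + 1)) * PowerSeries.coeff (k + 1) (genBernoulliSeries ℓ x)
        + (x - ℓ) * PowerSeries.coeff k (genBernoulliSeries ℓ x) := by
  have h := congrArg (PowerSeries.coeff (k + 1)) (X_mul_derivative_genBernoulliSeries ℓ x)
  rw [map_sub, map_add] at h
  simp only [PowerSeries.coeff_succ_X_mul, PowerSeries.coeff_C_mul,
    PowerSeries.coeff_derivative] at h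
  linear_combination h

/-- `f ^ (ℓ + 1) e ^ t = f ^ (ℓ + 1) + t f ^ ℓ`, because `f (e ^ t - 1) = t`. -/
theorem genBernoulliSeries_add_one_add_one (ℓ x : ℚ) :
    genBernoulliSeries (ℓ + 1) (x + 1) =
      genBernoulliSeries (ℓ + 1) x + PowerSeries.X * genBernoulliSeries ℓ x := by
  have h1 := bernoulliPowerSeries_mul_exp_sub_one ℚ
  rw [genBernoulliSeries_add, genBernoulliSeries, genBernoulliSeries,
    powRat_add_one constantCoeff_bernoulliPowerSeries, PowerSeries.rescale_one, RingHom.id_apply]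
  linear_combination powRat (bernoulliPowerSeries ℚ) ℓ *
    PowerSeries.rescale x (PowerSeries.exp ℚ) * h1

/-! ### Expansions of quotients of Gamma functions -/

/-- The falling factorial `α (α - 1) ⋯ (α - k + 1)`. -/
def falling (α : ℚ) (k : ℕ) : ℚ := k.factorial * Ring.choose α k

theorem falling_zero (α : ℚ) : falling α 0 = 1 := by
  simp [falling]

theorem falling_add (α : ℚ) (p c : ℕ) :
    falling α (p + c) = falling α p * falling (α - p) c := by
  have h := Ring.choose_smul_choose α (Nat.le_add_right p c)
  rw [Nat.add_sub_cancel_left, nsmul_eq_mul] at h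
  have h2 : ((p + c).choose p : ℚ) * p.factorial * c.factorial = (p + c).factorial := by
    rw [Nat.choose_symm_add]
    exact_mod_cast Nat.add_choose_mul_factorial_mul_factorial p c
  simp only [falling]
  rw [← h2]
  linear_combination (p.factorial : ℚ) * c.factorial * h

theorem falling_one (α : ℚ) : falling α 1 = α := by
  simp [falling]

theorem falling_succ (α : ℚ) (k : ℕ) : falling α (k + 1) = falling α k * (α - k) := by
  rw [falling_add, falling_one]

theorem falling_succ' (α : ℚ) (k : ℕ) : falling (α + 1) (k + 1) = (α + 1) * falling α k := by
  rw [add_comm k 1, falling_add, falling_one]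
  simp

/-- The coefficient of `z ^ (α - k)` in the asymptotic expansion at `z → ∞` of
`m ^ α Γ(z / m + x) / Γ(z / m + x - α)`, extended by `0` to negative `k`. -/
def gammaCoeff (m α x : ℚ) (k : ℤ) : ℚ :=
  if 0 ≤ k then m ^ k.toNat * falling α k.toNat *
    PowerSeries.coeff k.toNat (genBernoulliSeries (1 + α) x) else 0

theorem gammaCoeff_natCast (m α x : ℚ) (k : ℕ) :
    gammaCoeff m α x k =
      m ^ k * falling α k * PowerSeries.coeff k (genBernoulliSeries (1 + α) x) := by
  simp [gammaCoeff]

theorem gammaCoeff_of_neg (m α x : ℚ) {k : ℤ} (hk : k < 0) : gammaCoeff m α x k = 0 :=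
  if_neg (not_le.2 hk)

theorem gammaCoeff_zero (m α x : ℚ) : gammaCoeff m α x 0 = 1 := by
  have := gammaCoeff_natCast m α x 0
  rw [Nat.cast_zero] at this
  rw [this, falling_zero, coeff_zero_genBernoulliSeries]
  simp

/-- With `w = z / m`, this is
`Γ(w + x) / Γ(w + x - α - 1) = (w + x - α - 1) Γ(w + x) / Γ(w + x - α)`. -/
theorem gammaCoeff_add_one (m α x : ℚ) (k : ℤ) :
    gammaCoeff m (α + 1) x k =
      gammaCoeff m α x k + m * (x - α - 1) * gammaCoeff m α x (k - 1) := by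
  rcases lt_or_ge k 0 with hk | hk
  · rw [gammaCoeff_of_neg _ _ _ hk, gammaCoeff_of_neg _ _ _ hk,
      gammaCoeff_of_neg _ _ _ (by lia)]
    ring
  lift k to ℕ using hk
  cases k with
  | zero =>
    rw [Nat.cast_zero, gammaCoeff_zero, gammaCoeff_zero, gammaCoeff_of_neg _ _ _ (by norm_num)]
    ring
  | succ k =>
    have h := coeff_genBernoulliSeries_add_one k (1 + α) x
    rw [show ((k + 1 : ℕ) : ℤ) - 1 = (k : ℕ) by push_cast; ring, gammaCoeff_natCast,
      gammaCoeff_natCast, gammaCoeff_natCast, falling_succ', falling_succ, pow_succ,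
      show 1 + (α + 1) = 1 + α + 1 by ring]
    linear_combination m ^ k * m * falling α k * h

/-- With `w = z / m`, this is
`Γ(w + x + 1) / Γ(w + x - α) = (w + x) Γ(w + x) / Γ(w + x - α)`. -/
theorem gammaCoeff_add_one_add_one (m α x : ℚ) (k : ℤ) :
    gammaCoeff m (α + 1) (x + 1) k =
      gammaCoeff m α x k + m * x * gammaCoeff m α x (k - 1) := by
  rcases lt_or_ge k 0 with hk | hk
  · rw [gammaCoeff_of_neg _ _ _ hk, gammaCoeff_of_neg _ _ _ hk,
      gammaCoeff_of_neg _ _ _ (by lia)]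
    ring
  lift k to ℕ using hk
  cases k with
  | zero =>
    rw [Nat.cast_zero, gammaCoeff_zero, gammaCoeff_zero, gammaCoeff_of_neg _ _ _ (by norm_num)]
    ring
  | succ k =>
    have h := coeff_genBernoulliSeries_add_one k (1 + α) x
    have h' := congrArg (PowerSeries.coeff (k + 1)) (genBernoulliSeries_add_one_add_one (1 + α) x)
    rw [map_add, PowerSeries.coeff_succ_X_mul] at h'
    rw [show ((k + 1 : ℕ) : ℤ) - 1 = (k : ℕ) by push_cast; ring, gammaCoeff_natCast,
      gammaCoeff_natCast, gammaCoeff_natCast, falling_succ', falling_succ, pow_succ,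
      show 1 + (α + 1) = 1 + α + 1 by ring]
    linear_combination m ^ k * m * falling α k * h + m ^ k * m * falling α k * (α + 1) * h'

/-- Substituting `z - 1` for `z` in the expansion of `Γ(z / m + x) / Γ(z / m + x - α)` amounts to
replacing `x` by `x - 1 / m`. -/
theorem sum_choose_mul_gammaCoeff {m : ℚ} (hm : m ≠ 0) (α x : ℚ) (k : ℤ) (n : ℕ) (hn : k < n) :
    ∑ c ∈ Finset.range n, (-1) ^ c * Ring.choose (α - (k - c)) c * gammaCoeff m α x (k - c) =
      gammaCoeff m α (x - 1 / m) k := by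
  rcases lt_or_ge k 0 with hk | hk
  · rw [gammaCoeff_of_neg _ _ _ hk]
    refine Finset.sum_eq_zero fun c _ => ?_
    rw [gammaCoeff_of_neg _ _ _ (by lia), mul_zero]
  lift k to ℕ using hk
  have hn' : k + 1 ≤ n := by exact_mod_cast hn
  rw [← Finset.sum_subset (Finset.range_mono hn')]
  swap
  · intro c _ hc
    rw [Finset.mem_range, not_lt] at hc
    rw [gammaCoeff_of_neg _ _ _ (by lia), mul_zero]
  rw [gammaCoeff_natCast, sub_eq_add_neg x, genBernoulliSeries_add, mul_comm (genBernoulliSeries _ _),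
    PowerSeries.coeff_mul, Finset.Nat.sum_antidiagonal_eq_sum_range_succ_mk, Finset.mul_sum]
  refine Finset.sum_congr rfl fun c hc => ?_
  -- Both sides are the sum of `m ^ p α (α - 1) ⋯ (α - k + 1) (-1) ^ c / c!` times the `p`-th
  -- coefficient of `genBernoulliSeries (1 + α) x`, over `p + c = k`.
  obtain ⟨p, rfl⟩ : ∃ p, k = p + c := ⟨k - c, by rw [Finset.mem_range] at hc; lia⟩
  rw [show ((p + c : ℕ) : ℤ) - (c : ℤ) = (p : ℕ) by push_cast; ring, gammaCoeff_natCast,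
    falling_add, Nat.add_sub_cancel, PowerSeries.coeff_rescale, PowerSeries.coeff_exp, falling.eq_1 _ c,
    show α - (((p + c : ℕ) : ℤ) - c : ℚ) = α - p by push_cast; ring]
  have : (c.factorial : ℚ) ≠ 0 := by positivity
  simp only [eq_ratCast, Rat.cast_id]
  rw [neg_pow (1 / m), one_div_pow, pow_add]
  field_simp

/-! ### Finite differences of Gamma quotients -/

/-- The reciprocal factorial `1 / n!`, equal to `0` for negative `n`. -/
def invFactorial (n : ℤ) : ℚ := if 0 ≤ n then ((n.toNat.factorial : ℚ))⁻¹ else 0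

theorem invFactorial_sub_one (n : ℤ) : invFactorial (n - 1) = n * invFactorial n := by
  rcases lt_trichotomy n 0 with hn | rfl | hn
  · rw [invFactorial, if_neg (by lia), invFactorial, if_neg (by lia), mul_zero]
  · simp [invFactorial]
  · obtain ⟨k, rfl⟩ : ∃ k : ℕ, n = k + 1 := ⟨(n - 1).toNat, by lia⟩
    rw [invFactorial, if_pos (by lia), invFactorial, if_pos (by lia), add_sub_cancel_right,
      Int.toNat_natCast, Int.toNat_natCast_add_one, Nat.factorial_succ]
    have : (k.factorial : ℚ) ≠ 0 := by positivity
    push_cast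
    field_simp

theorem invFactorial_of_neg {n : ℤ} (hn : n < 0) : invFactorial n = 0 := if_neg (not_le.2 hn)

/-- The coefficients of `d ^ (-N) ∑ c, (-1) ^ c / (c! (N - c)!) R(α, x + d c / m)`, where
`R(α, x)` is the series with coefficients `gammaCoeff m α x`. It vanishes for negative `N`. -/
def diffCoeff (d m α x : ℚ) (N k : ℤ) : ℚ :=
  (d ^ N)⁻¹ * ∑ c ∈ Finset.Icc 0 N,
    (-1) ^ c.toNat * invFactorial c * invFactorial (N - c) * gammaCoeff m α (x + d * c / m) k

/-- Lowering `N` multiplies the summand of index `c` by `d (N - c)`. -/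
theorem diffCoeff_sub_one {d : ℚ} (hd : d ≠ 0) (m α x : ℚ) (N k : ℤ) :
    diffCoeff d m α x (N - 1) k = (d ^ N)⁻¹ * ∑ c ∈ Finset.Icc 0 N,
      (-1) ^ c.toNat * invFactorial c * invFactorial (N - c) * (d * (N - c)) *
        gammaCoeff m α (x + d * c / m) k := by
  rw [diffCoeff, zpow_sub_one₀ hd, mul_inv, inv_inv, mul_assoc]
  congr 1
  rw [Finset.sum_subset (Finset.Icc_subset_Icc_right (sub_one_lt N).le), Finset.mul_sum]
  · refine Finset.sum_congr rfl fun c _ => ?_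
    rw [show N - 1 - c = N - c - 1 by ring, invFactorial_sub_one]
    push_cast
    ring
  · intro c hc hc'
    rw [Finset.mem_Icc] at hc hc'
    rw [invFactorial_of_neg (n := N - 1 - c) (by lia)]
    ring

theorem diffCoeff_of_neg (d m α x : ℚ) {k : ℤ} (hk : k < 0) (N : ℤ) :
    diffCoeff d m α x N k = 0 := by
  rw [diffCoeff, Finset.sum_eq_zero, mul_zero]
  intro c _
  rw [gammaCoeff_of_neg _ _ _ hk, mul_zero]

theorem diffCoeff_of_neg_right (d m α x : ℚ) {N : ℤ} (hN : N < 0) (k : ℤ) :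
    diffCoeff d m α x N k = 0 := by
  rw [diffCoeff, Finset.Icc_eq_empty (not_le.2 hN), Finset.sum_empty, mul_zero]

/-- The summand of index `c` of the first series is multiplied by `z + m x + d c`, and that of the
second one by `d (N - c)`, so that the total factor `z + m x + d N` does not depend on `c`. -/
theorem diffCoeff_add_one_add_one {d m : ℚ} (hd : d ≠ 0) (hm : m ≠ 0) (α x : ℚ) (N k : ℤ) :
    diffCoeff d m (α + 1) (x + 1) N k + diffCoeff d m α x (N - 1) (k - 1) =
      diffCoeff d m α x N k + (m * x + d * N) * diffCoeff d m α x N (k - 1) := by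
  rw [diffCoeff_sub_one hd]
  simp only [diffCoeff, Finset.mul_sum]
  rw [← Finset.sum_add_distrib, ← Finset.sum_add_distrib]
  generalize (d ^ N)⁻¹ = D
  refine Finset.sum_congr rfl fun c _ => ?_
  rw [add_right_comm, gammaCoeff_add_one_add_one]
  field_simp
  ring

/-- The summand of index `c` of the first series is multiplied by `z + m (x - α - 1) + d c`, and that
of the second one, after moving `c` by one, by `-d c`. -/
theorem diffCoeff_add_one {d m : ℚ} (hd : d ≠ 0) (hm : m ≠ 0) (α x : ℚ) (N k : ℤ) :
    diffCoeff d m (α + 1) x N k + diffCoeff d m α (x + d / m) (N - 1) (k - 1) =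
      diffCoeff d m α x N k + m * (x - α - 1) * diffCoeff d m α x N (k - 1) := by
  have key : diffCoeff d m α (x + d / m) (N - 1) (k - 1) = (d ^ N)⁻¹ * ∑ c ∈ Finset.Icc 0 N,
      -((-1) ^ c.toNat * invFactorial c * invFactorial (N - c) * (d * c) *
        gammaCoeff m α (x + d * c / m) (k - 1)) := by
    rw [diffCoeff, zpow_sub_one₀ hd, mul_inv, inv_inv, mul_assoc]
    congr 1
    have h1 : Finset.Icc 1 N = (Finset.Icc 0 (N - 1)).map (addRightEmbedding (1 : ℤ)) := by
      simp
    rw [← Finset.sum_subset (Finset.Icc_subset_Icc_left zero_le_one : Finset.Icc 1 N ⊆ _), h1,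
      Finset.sum_map,
      Finset.mul_sum]
    · refine Finset.sum_congr rfl fun c hc => ?_
      rw [Finset.mem_Icc] at hc
      have h2 := invFactorial_sub_one (c + 1)
      rw [add_sub_cancel_right] at h2
      rw [addRightEmbedding_apply, h2, show (c + 1).toNat = c.toNat + 1 by lia, pow_succ,
        show N - (c + 1) = N - 1 - c by ring,
        show x + d * ((c + 1 : ℤ) : ℚ) / m = x + d / m + d * c / m by push_cast; ring]
      push_cast
      ring
    · intro c hc hc'
      obtain rfl : c = 0 := by rw [Finset.mem_Icc] at hc hc'; lia
      simp
  rw [key]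
  simp only [diffCoeff, Finset.mul_sum]
  rw [← Finset.sum_add_distrib, ← Finset.sum_add_distrib]
  generalize (d ^ N)⁻¹ = D
  refine Finset.sum_congr rfl fun c _ => ?_
  rw [gammaCoeff_add_one]
  field_simp
  ring

theorem sum_choose_mul_diffCoeff (d : ℚ) {m : ℚ} (hm : m ≠ 0) (α x : ℚ) (N k : ℤ) (n : ℕ)
    (hn : k < n) :
    ∑ c ∈ Finset.range n, (-1) ^ c * Ring.choose (α - (k - c)) c * diffCoeff d m α x N (k - c) =
      diffCoeff d m α (x - 1 / m) N k := by
  simp only [diffCoeff, Finset.mul_sum]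
  rw [Finset.sum_comm]
  refine Finset.sum_congr rfl fun b _ => ?_
  rw [sub_add_eq_add_sub, ← sum_choose_mul_gammaCoeff hm _ _ k n hn, Finset.mul_sum,
    Finset.mul_sum]
  refine Finset.sum_congr rfl fun c _ => ?_
  ring

/-! ### The explicit series for all integer indices -/

/-- The contribution of `ℓ₂ = ℓ` to the coefficient of `z ^ (-a/m₁ - ℓ - k)` in `g_a(z, i, j)`, for
`a ≤ m₁`. The indices `i` and `j` are arbitrary integers. -/
def term (m₁ m₂ a : ℕ) (i j ℓ k : ℤ) : Coef :=
  if (m₂ : ℤ) ∣ m₁ * ℓ + a + j - i then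
    s ^ (ℓ + (m₁ * ℓ + a + j - i) / m₂ + 1) *
      (diffCoeff m₂ m₁ (-ℓ - a / m₁) ((i - 1 / 2 - a) / m₁ - ℓ)
        ((m₁ * ℓ + a + j - i) / m₂) k : ℚ)
  else 0

theorem s_ne_zero : s ≠ 0 := RatFunc.X_ne_zero

section

variable {m₁ m₂ : ℕ}

/-- A contribution is nonzero only if `k ≥ 0` and `m₁ ℓ + a + j - i ≥ 0`, which bounds `ℓ` from both
sides. -/
theorem term_eq_zero (hm₁ : 0 < m₁) (hm₂ : 0 < m₂) (a : ℕ) {i j ℓ k : ℤ}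
    (h : k < 0 ∨ ℓ < -(|j - i| + a)) : term m₁ m₂ a i j ℓ k = 0 := by
  rw [term]
  split_ifs with hdvd
  · rcases h with hk | hl
    · rw [diffCoeff_of_neg _ _ _ _ hk, Rat.cast_zero, mul_zero]
    · have h1 : (m₁ : ℤ) * ℓ ≤ ℓ := by
        have : (1 : ℤ) ≤ m₁ := by exact_mod_cast hm₁
        have h0 := abs_nonneg (j - i)
        nlinarith
      have h2 := le_abs_self (j - i)
      have h3 : (m₁ * ℓ + a + j - i) / (m₂ : ℤ) < 0 :=
        Int.ediv_neg_of_neg_of_pos (by lia) (by exact_mod_cast hm₂)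
      rw [diffCoeff_of_neg_right _ _ _ _ h3, Rat.cast_zero, mul_zero]
  · rfl

/-- The `ℓ`-th contribution to the relation `extSer_add_left`. Raising `j` by `m₁` is compensated by
lowering `ℓ` by one, and lowering `j` by `m₂` lowers the number `N = (m₁ ℓ + a + j - i) / m₂` by
one. -/
theorem term_add_left (hm₁ : 0 < m₁) (hm₂ : 0 < m₂) (a : ℕ) (i j ℓ k : ℤ) :
    s * (term m₁ m₂ a i (j + m₁) (ℓ - 1) k + term m₁ m₂ a i (j - m₂) ℓ (k - 1)) =
      term m₁ m₂ a i j ℓ k + ((j - 1 / 2 : ℚ) : Coef) * term m₁ m₂ a i j ℓ (k - 1) := by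
  have hm₁' : (m₁ : ℚ) ≠ 0 := by positivity
  have hm₂' : (m₂ : ℚ) ≠ 0 := by positivity
  have hm₂'' : (m₂ : ℤ) ≠ 0 := by positivity
  simp only [term]
  rw [show (m₁ : ℤ) * (ℓ - 1) + a + (j + m₁) - i = m₁ * ℓ + a + j - i by ring,
    show (m₁ : ℤ) * ℓ + a + (j - m₂) - i = m₁ * ℓ + a + j - i - m₂ by ring]
  by_cases h : (m₂ : ℤ) ∣ m₁ * ℓ + a + j - i
  · obtain ⟨N, hN⟩ := h
    have hx : (m₁ : ℚ) * ((i - 1 / 2 - a) / m₁ - ℓ) + m₂ * N = j - 1 / 2 := by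
      have : (m₁ : ℚ) * ℓ + a + j - i = m₂ * N := by exact_mod_cast hN
      field_simp
      linarith
    have key := congrArg (Rat.cast : ℚ → Coef) (diffCoeff_add_one_add_one hm₂' hm₁'
      (-ℓ - a / m₁) ((i - 1 / 2 - a) / m₁ - ℓ) N k)
    rw [hx] at key
    rw [hN, show (m₂ : ℤ) * N - m₂ = m₂ * (N - 1) by ring]
    simp only [dvd_mul_right, if_true, Int.mul_ediv_cancel_left _ hm₂'']
    rw [show (-((ℓ - 1 : ℤ) : ℚ) - a / m₁) = -ℓ - a / m₁ + 1 by push_cast; ring,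
      show ((i : ℚ) - 1 / 2 - a) / m₁ - ((ℓ - 1 : ℤ) : ℚ) = (i - 1 / 2 - a) / m₁ - ℓ + 1 by
        push_cast; ring, show ℓ - 1 + N + 1 = ℓ + N by ring,
      show ℓ + (N - 1) + 1 = ℓ + N by ring, zpow_add_one₀ s_ne_zero]
    rw [Rat.cast_add, Rat.cast_add, Rat.cast_mul] at key
    linear_combination s ^ (ℓ + N) * s * key
  · rw [if_neg h, if_neg h, if_neg (by rwa [dvd_sub_self_right]), if_neg h]
    ring

/-- The `ℓ`-th contribution to the relation `extSer_add_right`. -/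
theorem term_add_right (hm₁ : 0 < m₁) (hm₂ : 0 < m₂) (a : ℕ) (i j ℓ k : ℤ) :
    s * (term m₁ m₂ a (i - m₁) j (ℓ - 1) k + term m₁ m₂ a (i + m₂) j ℓ (k - 1)) =
      term m₁ m₂ a i j ℓ k + ((i - m₁ - 1 / 2 : ℚ) : Coef) * term m₁ m₂ a i j ℓ (k - 1) := by
  have hm₁' : (m₁ : ℚ) ≠ 0 := by positivity
  have hm₂' : (m₂ : ℚ) ≠ 0 := by positivity
  have hm₂'' : (m₂ : ℤ) ≠ 0 := by positivity
  simp only [term]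
  rw [show (m₁ : ℤ) * (ℓ - 1) + a + j - (i - m₁) = m₁ * ℓ + a + j - i by ring,
    show (m₁ : ℤ) * ℓ + a + j - (i + m₂) = m₁ * ℓ + a + j - i - m₂ by ring]
  by_cases h : (m₂ : ℤ) ∣ m₁ * ℓ + a + j - i
  · obtain ⟨N, hN⟩ := h
    have hx : (m₁ : ℚ) * ((i - 1 / 2 - a) / m₁ - ℓ - (-ℓ - a / m₁) - 1) = i - m₁ - 1 / 2 := by
      field_simp
      ring
    have key := congrArg (Rat.cast : ℚ → Coef) (diffCoeff_add_one hm₂' hm₁'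
      (-ℓ - a / m₁) ((i - 1 / 2 - a) / m₁ - ℓ) N k)
    rw [hx] at key
    rw [hN, show (m₂ : ℤ) * N - m₂ = m₂ * (N - 1) by ring]
    simp only [dvd_mul_right, if_true, Int.mul_ediv_cancel_left _ hm₂'']
    rw [show (-((ℓ - 1 : ℤ) : ℚ) - a / m₁) = -ℓ - a / m₁ + 1 by push_cast; ring,
      show (((i - m₁ : ℤ) : ℚ) - 1 / 2 - a) / m₁ - ((ℓ - 1 : ℤ) : ℚ) =
        (i - 1 / 2 - a) / m₁ - ℓ by push_cast; field_simp; ring,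
      show (((i + m₂ : ℤ) : ℚ) - 1 / 2 - a) / m₁ - ℓ = (i - 1 / 2 - a) / m₁ - ℓ + m₂ / m₁ by
        push_cast; ring,
      show ℓ - 1 + N + 1 = ℓ + N by ring,
      show ℓ + (N - 1) + 1 = ℓ + N by ring, zpow_add_one₀ s_ne_zero]
    rw [Rat.cast_add, Rat.cast_add, Rat.cast_mul] at key
    linear_combination s ^ (ℓ + N) * s * key
  · rw [if_neg h, if_neg h, if_neg (by rwa [dvd_sub_self_right]), if_neg h]
    ring

/-- The `ℓ`-th contribution to `shift_extSer`: moving both `i` and `j` by one only moves the argument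
`x` of the Gamma quotient by `1 / m₁`. -/
theorem sum_choose_mul_term (hm₁ : 0 < m₁) (a : ℕ) (i j ℓ k : ℤ) (n : ℕ) (hn : k < n) :
    ∑ c ∈ Finset.range n, (((-1) ^ c * Ring.choose (-ℓ - a / m₁ - (k - c) : ℚ) c : ℚ) : Coef) *
      term m₁ m₂ a (i + 1) (j + 1) ℓ (k - c) = term m₁ m₂ a i j ℓ k := by
  have hm₁' : (m₁ : ℚ) ≠ 0 := by positivity
  simp only [term]
  rw [show (m₁ : ℤ) * ℓ + a + (j + 1) - (i + 1) = m₁ * ℓ + a + j - i by ring]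
  split_ifs
  · have hx : ((i : ℚ) - 1 / 2 - a) / m₁ - ℓ =
        (((i + 1 : ℤ) : ℚ) - 1 / 2 - a) / m₁ - ℓ - 1 / m₁ := by push_cast; ring
    rw [hx, ← sum_choose_mul_diffCoeff _ hm₁' _ _ _ k n hn, Rat.cast_sum, Finset.mul_sum]
    refine Finset.sum_congr rfl fun c _ => ?_
    simp only [Rat.cast_mul]
    ring
  · simp

/-- The coefficient of `z ^ (-a/m₁ - n)` in `g_a(z, i, j)`, for `a ≤ m₁` and arbitrary integers
`i` and `j`. The sum over `ℓ` has finitely many nonzero terms. -/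
def extCoeff (m₁ m₂ a : ℕ) (i j n : ℤ) : Coef := ∑ᶠ ℓ : ℤ, term m₁ m₂ a i j ℓ (n - ℓ)

theorem support_term_subset (hm₁ : 0 < m₁) (hm₂ : 0 < m₂) (a : ℕ) {i j n L U : ℤ}
    (hL : L ≤ -(|j - i| + a)) (hU : n ≤ U) :
    (Function.support fun ℓ : ℤ => term m₁ m₂ a i j ℓ (n - ℓ)) ⊆ Finset.Icc L U := by
  intro ℓ hl
  rw [Finset.coe_Icc, Set.mem_Icc]
  by_contra h
  exact hl (term_eq_zero hm₁ hm₂ a (by lia))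

theorem extCoeff_eq_sum (hm₁ : 0 < m₁) (hm₂ : 0 < m₂) (a : ℕ) {i j n L U : ℤ}
    (hL : L ≤ -(|j - i| + a)) (hU : n ≤ U) :
    extCoeff m₁ m₂ a i j n = ∑ ℓ ∈ Finset.Icc L U, term m₁ m₂ a i j ℓ (n - ℓ) :=
  finsum_eq_sum_of_support_subset _ (support_term_subset hm₁ hm₂ a hL hU)

theorem finite_support_term (hm₁ : 0 < m₁) (hm₂ : 0 < m₂) (a : ℕ) (i j n : ℤ) :
    (Function.support fun ℓ : ℤ => term m₁ m₂ a i j ℓ (n - ℓ)).Finite :=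
  (Finset.finite_toSet _).subset (support_term_subset hm₁ hm₂ a le_rfl le_rfl)

theorem extCoeff_eq_zero (hm₁ : 0 < m₁) (hm₂ : 0 < m₂) (a : ℕ) {i j n : ℤ}
    (h : n < -(|j - i| + a)) : extCoeff m₁ m₂ a i j n = 0 := by
  rw [extCoeff_eq_sum hm₁ hm₂ a le_rfl le_rfl, Finset.Icc_eq_empty (not_le.2 h), Finset.sum_empty]

/-- Sums over `ℓ` of the identities `term_add_left` and `term_add_right`. -/
theorem finsum_term_add (hm₁ : 0 < m₁) (hm₂ : 0 < m₂) (a : ℕ) {i j i₁ j₁ i₂ j₂ : ℤ} (x : Coef)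
    (h : ∀ ℓ k, s * (term m₁ m₂ a i₁ j₁ (ℓ - 1) k + term m₁ m₂ a i₂ j₂ ℓ (k - 1)) =
      term m₁ m₂ a i j ℓ k + x * term m₁ m₂ a i j ℓ (k - 1)) (n : ℤ) :
    s * (extCoeff m₁ m₂ a i₁ j₁ n + extCoeff m₁ m₂ a i₂ j₂ n) =
      extCoeff m₁ m₂ a i j (n + 1) + x * extCoeff m₁ m₂ a i j n := by
  have hf := finite_support_term hm₁ hm₂ a
  have h1 : extCoeff m₁ m₂ a i₁ j₁ n = ∑ᶠ ℓ : ℤ, term m₁ m₂ a i₁ j₁ (ℓ - 1) (n + 1 - ℓ) := by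
    rw [extCoeff, ← finsum_comp_equiv (Equiv.subRight (1 : ℤ))]
    refine finsum_congr fun ℓ => ?_
    rw [Equiv.subRight_apply, show n - (ℓ - 1) = n + 1 - ℓ by ring]
  have hf1 : (Function.support fun ℓ : ℤ => term m₁ m₂ a i₁ j₁ (ℓ - 1) (n + 1 - ℓ)).Finite := by
    refine ((hf i₁ j₁ n).preimage ((Equiv.subRight (1 : ℤ)).injective.injOn)).subset ?_
    intro ℓ hl
    simpa [show n - (ℓ - 1) = n + 1 - ℓ by ring] using hl
  rw [h1, extCoeff, extCoeff, extCoeff, ← finsum_add_distrib hf1 (hf _ _ _), mul_finsum,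
    mul_finsum, ← finsum_add_distrib (hf _ _ _)]
  · refine finsum_congr fun ℓ => ?_
    rw [show n - ℓ = n + 1 - ℓ - 1 by ring, h]
  · exact (hf i j n).subset (Function.support_mul_subset_right _ _)

theorem finsum_choose_mul_extCoeff (hm₁ : 0 < m₁) (hm₂ : 0 < m₂) (a : ℕ) (i j n : ℤ) :
    ∑ᶠ k : ℕ, (((-1) ^ k * Ring.choose (-((n : ℚ) + a / m₁ - k)) k : ℚ) : Coef) *
      extCoeff m₁ m₂ a (i + 1) (j + 1) (n - k) = extCoeff m₁ m₂ a i j n := by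
  set L : ℤ := -(|j - i| + a) with hL
  have hL' : L ≤ -(|j + 1 - (i + 1)| + a) := by rw [add_sub_add_right_eq_sub]
  have hK : ∀ ℓ ∈ Finset.Icc L n, n - ℓ < ((n - L).toNat + 1 : ℕ) := by
    intro ℓ hl
    rw [Finset.mem_Icc] at hl
    lia
  -- The ranges of `ℓ` and `k` are truncated to common finite sets, to exchange the two sums.
  rw [extCoeff_eq_sum hm₁ hm₂ a le_rfl le_rfl (i := i),
    finsum_eq_sum_of_support_subset (s := Finset.range ((n - L).toNat + 1))]
  · rw [Finset.sum_congr rfl fun ℓ hl =>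
      (sum_choose_mul_term (m₂ := m₂) hm₁ a i j ℓ (n - ℓ) _ (hK ℓ hl)).symm, Finset.sum_comm]
    refine Finset.sum_congr rfl fun k _ => ?_
    rw [extCoeff_eq_sum hm₁ hm₂ a hL' (show n - (k : ℤ) ≤ n by lia), Finset.mul_sum]
    refine Finset.sum_congr rfl fun ℓ _ => ?_
    rw [show n - (k : ℤ) - ℓ = n - ℓ - k by ring]
    congr 4
    push_cast
    ring
  · intro k hk
    rw [Finset.coe_range, Set.mem_Iio]
    by_contra h
    refine hk ?_
    simp only
    rw [extCoeff_eq_zero hm₁ hm₂ a (by lia), mul_zero]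

end

/-! ### Comparison with the given coefficients -/

theorem sum_invFactorial_mul_invFactorial (N : ℤ) :
    ∑ c ∈ Finset.Icc 0 N, (-1) ^ c.toNat * invFactorial c * invFactorial (N - c) =
      if N = 0 then 1 else 0 := by
  rcases lt_or_ge N 0 with hN | hN
  · rw [Finset.Icc_eq_empty (not_le.2 hN), Finset.sum_empty, if_neg hN.ne]
  lift N to ℕ using hN
  have h1 : Finset.Icc 0 (N : ℤ) = (Finset.range (N + 1)).map Nat.castEmbedding := by
    ext c
    simp only [Finset.mem_Icc, Finset.mem_map, Finset.mem_range, Nat.castEmbedding_apply]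
    exact ⟨fun h => ⟨c.toNat, by lia, by lia⟩, by rintro ⟨b, hb, rfl⟩; lia⟩
  have h2 : ∀ c ∈ Finset.range (N + 1), (-1 : ℚ) ^ (c : ℤ).toNat * invFactorial c *
      invFactorial (N - c) = ((N.factorial : ℚ))⁻¹ * ((-1 : ℤ) ^ c * (N.choose c : ℤ) : ℤ) := by
    intro c hc
    have hc' : c ≤ N := by rw [Finset.mem_range] at hc; lia
    rw [invFactorial, if_pos (by lia), invFactorial, if_pos (by lia), Int.toNat_natCast,
      show ((N : ℤ) - c).toNat = N - c by lia]
    push_cast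
    rw [Nat.cast_choose ℚ hc']
    have : (N.factorial : ℚ) ≠ 0 := by positivity
    field_simp
  rw [h1, Finset.sum_map]
  simp only [Nat.castEmbedding_apply]
  rw [Finset.sum_congr rfl h2, ← Finset.mul_sum, ← Int.cast_sum, Int.alternating_sum_range_choose]
  rcases N with _ | N
  · simp
  · rw [if_neg N.succ_ne_zero, if_neg (by lia), Int.cast_zero, mul_zero]

theorem diffCoeff_zero_right (d m α x : ℚ) (N : ℤ) :
    diffCoeff d m α x N 0 = if N = 0 then 1 else 0 := by
  simp only [diffCoeff, gammaCoeff_zero, mul_one]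
  rw [sum_invFactorial_mul_invFactorial]
  split_ifs with h <;> simp [h]

section

variable {m₁ m₂ : ℕ}

/-- For indices in the range that occurs in the matrix, only `ℓ ≥ -1` contribute. -/
theorem extCoeff_eq_sum_Icc (hm₁ : 0 < m₁) (hm₂ : 0 < m₂) (a : ℕ) {i j : ℤ}
    (h : a + j - i < 2 * m₁) (n : ℤ) :
    extCoeff m₁ m₂ a i j n = ∑ ℓ ∈ Finset.Icc (-1) n, term m₁ m₂ a i j ℓ (n - ℓ) := by
  rw [extCoeff_eq_sum hm₁ hm₂ a (L := min (-1) (-(|j - i| + a))) (min_le_right _ _) le_rfl]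
  refine (Finset.sum_subset (Finset.Icc_subset_Icc_left (min_le_left _ _)) ?_).symm
  intro ℓ hl hl'
  rw [Finset.mem_Icc] at hl hl'
  have hl2 : ℓ ≤ -2 := by lia
  rw [term]
  split_ifs
  · have h1 : (m₁ : ℤ) * ℓ ≤ m₁ * (-2) := mul_le_mul_of_nonneg_left hl2 (by positivity)
    have h3 : (m₁ * ℓ + a + j - i) / (m₂ : ℤ) < 0 :=
      Int.ediv_neg_of_neg_of_pos (by lia) (by exact_mod_cast hm₂)
    rw [diffCoeff_of_neg_right _ _ _ _ h3, Rat.cast_zero, mul_zero]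
  · rfl

theorem extCoeff_eq_gCoeffLow (hm₁ : 0 < m₁) (hm₂ : 0 < m₂) (a : ℕ) {i j : ℤ}
    (h : a + j - i < 2 * m₁) (n : ℤ) :
    extCoeff m₁ m₂ a i j n = gCoeffLow m₁ m₂ a i j n := by
  have hm₁' : (m₁ : ℚ) ≠ 0 := by positivity
  have hm₁'' : (m₁ : Coef) ≠ 0 := by exact_mod_cast hm₁.ne'
  have hm₂' : (m₂ : ℤ) ≠ 0 := by positivity
  rw [extCoeff_eq_sum_Icc hm₁ hm₂ a h, gCoeffLow, Finset.mul_sum]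
  refine Finset.sum_congr rfl fun ℓ hl => ?_
  rw [Finset.mem_Icc] at hl
  rw [term]
  split_ifs with hd
  swap
  · rw [mul_zero]
  rw [show ((m₁ + m₂ : ℤ) * ℓ + a + j - i) = (m₁ * ℓ + a + j - i) + ℓ * m₂ by ring,
    Int.add_mul_ediv_right _ _ hm₂']
  generalize ((m₁ : ℤ) * ℓ + a + j - i) / m₂ = N
  obtain ⟨k, rfl⟩ : ∃ k : ℕ, n = ℓ + k := ⟨(n - ℓ).toNat, by lia⟩
  rw [add_sub_cancel_left, Int.toNat_natCast]
  have key : diffCoeff m₂ m₁ (-ℓ - a / m₁) ((i - 1 / 2 - a) / m₁ - ℓ) N k =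
      (m₁ : ℚ) ^ k * ((m₂ : ℚ) ^ N)⁻¹ * ∑ ℓ₃ ∈ Finset.Icc 0 N,
          (-1) ^ ℓ₃.toNat * Ring.choose (-(ℓ : ℚ) - a / m₁) k /
              ((ℓ₃.toNat.factorial : ℚ) * ((N - ℓ₃).toNat.factorial : ℚ)) *
            genBernoulli k (1 - ℓ - a / m₁) (((i : ℚ) - 1 / 2 - a + m₂ * ℓ₃) / m₁ - ℓ) := by
    rw [diffCoeff, mul_comm ((m₁ : ℚ) ^ k), mul_assoc]
    congr 1
    rw [Finset.mul_sum]
    refine Finset.sum_congr rfl fun c hc => ?_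
    rw [Finset.mem_Icc] at hc
    rw [invFactorial, if_pos hc.1, invFactorial, if_pos (by lia), gammaCoeff_natCast, falling,
      genBernoulli, genBernoulliSeries,
      show (1 : ℚ) + (-ℓ - a / m₁) = 1 - ℓ - a / m₁ by ring,
      show ((i : ℚ) - 1 / 2 - a) / m₁ - ℓ + m₂ * c / m₁ = (i - 1 / 2 - a + m₂ * c) / m₁ - ℓ by
        ring]
    ring
  rw [key, Rat.cast_mul, Rat.cast_mul, Rat.cast_pow, Rat.cast_inv, Rat.cast_zpow,
    Rat.cast_natCast, Rat.cast_natCast, zpow_add₀ hm₁'', zpow_natCast, add_comm ℓ N]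
  have aux : ∀ S : Coef, s ^ (N + ℓ + 1) * ((m₁ : Coef) ^ k * ((m₂ : Coef) ^ N)⁻¹ * S) =
      (m₁ : Coef) ^ ℓ * (m₁ : Coef) ^ k *
        (s ^ (N + ℓ + 1) / ((m₁ : Coef) ^ ℓ * (m₂ : Coef) ^ N) * S) := by
    intro S
    field_simp
  exact aux _

/-- The case `a > m₁` is the case `a ≤ m₁` with `m₁` and `m₂` exchanged, `a` replaced by `l - a`, and
`(i, j)` replaced by `(j + m₂, i - m₁)`. -/
theorem gCoeffHigh_eq_gCoeffLow {a : ℕ} (ha : a ≤ m₁ + m₂) (i j n : ℤ) :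
    gCoeffHigh m₁ m₂ a i j n = gCoeffLow m₂ m₁ (m₁ + m₂ - a) (j + m₂) (i - m₁) n := by
  rw [gCoeffHigh, gCoeffLow]
  have h1 : ∀ ℓ : ℤ, (m₂ : ℤ) * ℓ + (m₁ + m₂ - a : ℕ) + (i - m₁) - (j + m₂) =
      m₂ * ℓ + i - j - a := by
    intro ℓ
    push_cast [Nat.cast_sub ha]
    ring
  have h2 : ∀ ℓ : ℤ, (m₂ + m₁ : ℤ) * ℓ + (m₁ + m₂ - a : ℕ) + (i - m₁) - (j + m₂) =
      (m₁ + m₂ : ℤ) * ℓ + i - j - a := by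
    intro ℓ
    push_cast [Nat.cast_sub ha]
    ring
  have h3 : ((m₁ + m₂ - a : ℕ) : ℚ) = m₁ + m₂ - a := by push_cast [Nat.cast_sub ha]; ring
  have h4 : ∀ c : ℤ, ((j + m₂ : ℤ) : ℚ) - 1 / 2 - (m₁ + m₂ - a) + m₁ * c =
      j - 1 / 2 + a - m₁ + m₁ * c := by
    intro c
    push_cast
    ring
  have h5 : ∀ x y : ℤ, (m₁ : Coef) ^ x * (m₂ : Coef) ^ y = (m₂ : Coef) ^ y * (m₁ : Coef) ^ x :=
    fun x y => mul_comm _ _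
  simp only [h1, h2, h3, h4, h5]

/-- The coefficient of `z ^ (1 - a / m₁)`: only `ℓ = -1` contributes, through an alternating sum of
binomial coefficients, which vanishes unless `N = 0`. -/
theorem extCoeff_neg_one (hm₁ : 0 < m₁) (hm₂ : 0 < m₂) (a : ℕ) {i j : ℤ}
    (h : a + j - i < 2 * m₁) :
    extCoeff m₁ m₂ a i j (-1) = if j - i = m₁ - a then 1 else 0 := by
  have hm₂' : (m₂ : ℤ) ≠ 0 := by positivity
  rw [extCoeff_eq_sum_Icc hm₁ hm₂ a h, Finset.Icc_self, Finset.sum_singleton, term, sub_self,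
    diffCoeff_zero_right]
  by_cases hij : j - i = m₁ - a
  · rw [if_pos hij, show (m₁ : ℤ) * -1 + a + j - i = 0 by linarith]
    simp
  · rw [if_neg hij]
    split_ifs with hd hN
    · obtain ⟨N, hN'⟩ := hd
      rw [hN', Int.mul_ediv_cancel_left _ hm₂'] at hN
      rw [hN, mul_zero] at hN'
      exact absurd (by linarith) hij
    · simp
    · rfl

end

/-! ### Series in powers of `z⁻¹` -/

theorem coeff_zPow_mul (p : ℚ) (f : Ser) (r : ℚ) : (zPow p * f).coeff r = f.coeff (r + p) := by
  rw [zPow, HahnSeries.coeff_single_mul, one_mul, sub_neg_eq_add]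

theorem coeff_ofLaurent_intCast (F : LaurentSeries Coef) (n : ℤ) :
    (ofLaurent F).coeff (n : ℚ) = F.coeff n :=
  HahnSeries.embDomain_coeff (f := ⟨⟨Int.castAddHom ℚ, Int.cast_injective⟩, Int.cast_le⟩)

theorem coeff_ofLaurent_of_notMem (F : LaurentSeries Coef) {r : ℚ} (hr : ∀ n : ℤ, (n : ℚ) ≠ r) :
    (ofLaurent F).coeff r = 0 :=
  HahnSeries.embDomain_of_notMem_range (by rintro ⟨n, hn⟩; exact hr n hn)

theorem ofLaurent_C (x : Coef) : ofLaurent (HahnSeries.C x) = HahnSeries.C x :=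
  HahnSeries.embDomainRingHom_C

theorem ofLaurent_single (n : ℤ) : ofLaurent (HahnSeries.single (-n) 1) = zPow n := by
  rw [zPow, show (-(n : ℚ)) = Int.castAddHom ℚ (-n) by simp]
  exact HahnSeries.embDomain_single

/-- The Laurent series with the coefficients `extCoeff m₁ m₂ a i j`. -/
def extLaurent {m₁ m₂ : ℕ} (hm₁ : 0 < m₁) (hm₂ : 0 < m₂) (a : ℕ) (i j : ℤ) : LaurentSeries Coef :=
  HahnSeries.ofSuppBddBelow (extCoeff m₁ m₂ a i j)
    ⟨-(|j - i| + a), fun _ hn => not_lt.1 fun h => hn (extCoeff_eq_zero hm₁ hm₂ a h)⟩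

/-- The extension of the series `g_a(z, i, j)`, for `a ≤ m₁`, to arbitrary integers `i` and `j`. -/
def extSer {m₁ m₂ : ℕ} (hm₁ : 0 < m₁) (hm₂ : 0 < m₂) (a : ℕ) (i j : ℤ) : Ser :=
  zPow (-((a : ℚ) / m₁)) * ofLaurent (extLaurent hm₁ hm₂ a i j)

section

variable {m₁ m₂ : ℕ} (hm₁ : 0 < m₁) (hm₂ : 0 < m₂) (a : ℕ)

theorem coeff_extLaurent (i j n : ℤ) :
    (extLaurent hm₁ hm₂ a i j).coeff n = extCoeff m₁ m₂ a i j n :=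
  congrFun HahnSeries.coeff_ofSuppBddBelow n

/-- The series depends on `i` and `z` only through `z + i`, and on `j` and `z` only through `z + j`. -/
theorem shift_extSer (i j : ℤ) :
    shift (extSer hm₁ hm₂ a (i + 1) (j + 1)) = extSer hm₁ hm₂ a i j := by
  ext r
  simp only [shift, extSer, coeff_zPow_mul]
  by_cases hr : ∃ n : ℤ, (n : ℚ) = r + -((a : ℚ) / m₁)
  · obtain ⟨n, hn⟩ := hr
    rw [← hn, coeff_ofLaurent_intCast, coeff_extLaurent, ← finsum_choose_mul_extCoeff hm₁ hm₂]
    refine finsum_congr fun k => ?_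
    rw [show r - k + -((a : ℚ) / m₁) = ((n - k : ℤ) : ℚ) by push_cast; linarith,
      coeff_ofLaurent_intCast, coeff_extLaurent, show (n : ℚ) + a / m₁ = r by linarith]
  · push Not at hr
    rw [coeff_ofLaurent_of_notMem _ hr]
    refine (finsum_congr fun k => ?_).trans finsum_zero
    rw [coeff_ofLaurent_of_notMem, mul_zero]
    intro n hn
    refine hr (n + k) ?_
    push_cast
    linarith

/-- Passage from coefficients to series: multiplication by `z` raises the index by one. -/
theorem C_s_mul_extSer_add {i j i₁ j₁ i₂ j₂ : ℤ} (x : Coef)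
    (h : ∀ n, s * (extCoeff m₁ m₂ a i₁ j₁ n + extCoeff m₁ m₂ a i₂ j₂ n) =
      extCoeff m₁ m₂ a i j (n + 1) + x * extCoeff m₁ m₂ a i j n) :
    HahnSeries.C s * (extSer hm₁ hm₂ a i₁ j₁ + extSer hm₁ hm₂ a i₂ j₂) =
      (zPow 1 + HahnSeries.C x) * extSer hm₁ hm₂ a i j := by
  have key : HahnSeries.C s * (extLaurent hm₁ hm₂ a i₁ j₁ + extLaurent hm₁ hm₂ a i₂ j₂) =
      (HahnSeries.single (-1) 1 + HahnSeries.C x) * extLaurent hm₁ hm₂ a i j := by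
    ext n
    rw [add_mul, HahnSeries.C_mul_eq_smul, HahnSeries.C_mul_eq_smul, HahnSeries.coeff_smul,
      HahnSeries.coeff_add, HahnSeries.coeff_add, HahnSeries.coeff_smul,
      HahnSeries.coeff_single_mul, sub_neg_eq_add, one_mul, smul_eq_mul, smul_eq_mul]
    simp only [coeff_extLaurent]
    exact h n
  have key' := congrArg ofLaurent key
  rw [map_mul, map_mul, map_add, map_add, ofLaurent_C, ofLaurent_C, ofLaurent_single,
    Int.cast_one] at key'
  simp only [extSer]
  linear_combination zPow (-((a : ℚ) / m₁)) * key'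

/-- The three-term relation in `j`. -/
theorem extSer_add_left (i j : ℤ) :
    HahnSeries.C s * (extSer hm₁ hm₂ a i (j + m₁) + extSer hm₁ hm₂ a i (j - m₂)) =
      (zPow 1 + HahnSeries.C ((j - 1 / 2 : ℚ) : Coef)) * extSer hm₁ hm₂ a i j :=
  C_s_mul_extSer_add hm₁ hm₂ a _ (finsum_term_add hm₁ hm₂ a _ (term_add_left hm₁ hm₂ a i j))

/-- The three-term relation in `i`. -/
theorem extSer_add_right (i j : ℤ) :
    HahnSeries.C s * (extSer hm₁ hm₂ a (i - m₁) j + extSer hm₁ hm₂ a (i + m₂) j) =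
      (zPow 1 + HahnSeries.C ((i - m₁ - 1 / 2 : ℚ) : Coef)) * extSer hm₁ hm₂ a i j :=
  C_s_mul_extSer_add hm₁ hm₂ a _ (finsum_term_add hm₁ hm₂ a _ (term_add_right hm₁ hm₂ a i j))

end

/-! ### The entries of the difference equation -/

theorem mul_elem {R : Type} [CommRing R] {l : ℕ} (X : Matrix (Fin l) (Fin l) R) {p q : ℕ}
    {k : Fin l} (hk : (k : ℕ) + 1 = p) (i j : Fin l) :
    (X * (elem l p q : Matrix (Fin l) (Fin l) R)) i j = if (j : ℕ) + 1 = q then X i k else 0 := by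
  rw [Matrix.mul_apply, Finset.sum_eq_single k]
  · simp [elem, hk]
  · intro b _ hb
    have : (b : ℕ) + 1 ≠ p := fun h => hb (Fin.ext (by lia))
    simp [elem, this]
  · simp

theorem elem_mul {R : Type} [CommRing R] {l : ℕ} (X : Matrix (Fin l) (Fin l) R) {p q : ℕ}
    {k : Fin l} (hk : (k : ℕ) + 1 = q) (i j : Fin l) :
    ((elem l p q : Matrix (Fin l) (Fin l) R) * X) i j = if (i : ℕ) + 1 = p then X k j else 0 := by
  rw [Matrix.mul_apply, Finset.sum_eq_single k]
  · simp [elem, hk]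
  · intro b _ hb
    have : (b : ℕ) + 1 ≠ q := fun h => hb (Fin.ext (by lia))
    simp [elem, this]
  · simp

theorem sum_elem_apply {R : Type} [CommRing R] {l : ℕ} (i j : Fin l) :
    (∑ p ∈ Finset.Icc 2 l, elem (R := R) l p (p - 1)) i j =
      if (i : ℕ) = j + 1 then 1 else 0 := by
  rw [Matrix.sum_apply, Finset.sum_congr rfl (g := fun p : ℕ => if p = (i : ℕ) + 1 then
    (if (i : ℕ) = j + 1 then (1 : R) else 0) else 0), Finset.sum_ite_eq']
  · by_cases h : (i : ℕ) = j + 1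
    · rw [if_pos (Finset.mem_Icc.2 (by lia))]
    · simp [h]
  · intro p hp
    rw [Finset.mem_Icc] at hp
    simp only [elem, Matrix.of_apply]
    grind

theorem mul_sum_elem {R : Type} [CommRing R] {l : ℕ} (X : Matrix (Fin l) (Fin l) R) (i j : Fin l) :
    (X * (∑ p ∈ Finset.Icc 2 l, elem l p (p - 1) : Matrix (Fin l) (Fin l) R)) i j =
      if h : (j : ℕ) + 1 < l then X i ⟨j + 1, h⟩ else 0 := by
  rw [Matrix.mul_apply]
  simp only [sum_elem_apply]
  split_ifs with h
  · rw [Finset.sum_eq_single ⟨j + 1, h⟩]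
    · simp
    · intro b _ hb
      have : (b : ℕ) ≠ j + 1 := fun h => hb (Fin.ext h)
      simp [this]
    · simp
  · refine Finset.sum_eq_zero fun b _ => ?_
    rw [if_neg (by lia), mul_zero]

theorem sum_elem_mul {R : Type} [CommRing R] {l : ℕ} (X : Matrix (Fin l) (Fin l) R) (i j : Fin l) :
    ((∑ p ∈ Finset.Icc 2 l, elem l p (p - 1) : Matrix (Fin l) (Fin l) R) * X) i j =
      if h : 0 < (i : ℕ) then X ⟨i - 1, by lia⟩ j else 0 := by
  rw [Matrix.mul_apply]
  simp only [sum_elem_apply]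
  split_ifs with h
  · rw [Finset.sum_eq_single ⟨i - 1, by lia⟩]
    · rw [if_pos (by simp only; lia), one_mul]
    · intro b _ hb
      have : (i : ℕ) ≠ b + 1 := fun h => hb (Fin.ext (by simp only; lia))
      simp [this]
    · simp
  · refine Finset.sum_eq_zero fun b _ => ?_
    rw [if_neg (by lia), zero_mul]

section

variable {R : Type} [CommRing R] {m₁ m₂ : ℕ} (hm₁ : 0 < m₁) (hm₂ : 0 < m₂)

/-- The matrix `w e_{1,m₁} - c e_{1,l} + c ∑_{i=2}^l e_{i,i-1}` over an arbitrary ring. -/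
def companion (m₁ m₂ : ℕ) (w c : R) : Matrix (Fin (m₁ + m₂)) (Fin (m₁ + m₂)) R :=
  w • elem (m₁ + m₂) 1 m₁ - c • elem (m₁ + m₂) 1 (m₁ + m₂)
    + c • ∑ i ∈ Finset.Icc 2 (m₁ + m₂), elem (m₁ + m₂) i (i - 1)

include hm₁

theorem mul_companion_apply (w c : R) (X : Matrix (Fin (m₁ + m₂)) (Fin (m₁ + m₂)) R)
    (i j : Fin (m₁ + m₂)) :
    (X * companion m₁ m₂ w c) i j =
      (if (j : ℕ) + 1 = m₁ then w * X i ⟨0, by lia⟩ else 0)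
        - (if (j : ℕ) + 1 = m₁ + m₂ then c * X i ⟨0, by lia⟩ else 0)
        + (if h : (j : ℕ) + 1 < m₁ + m₂ then c * X i ⟨j + 1, h⟩ else 0) := by
  rw [companion, mul_add, mul_sub, Matrix.mul_smul, Matrix.mul_smul, Matrix.mul_smul,
    Matrix.add_apply, Matrix.sub_apply, Matrix.smul_apply, Matrix.smul_apply, Matrix.smul_apply,
    mul_elem X (k := ⟨0, by lia⟩) rfl, mul_elem X (k := ⟨0, by lia⟩) rfl, mul_sum_elem]
  simp only [smul_eq_mul, mul_ite, mul_dite, mul_zero]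

theorem mul_W_apply (X : Matrix (Fin (m₁ + m₂)) (Fin (m₁ + m₂)) Ser) (i j : Fin (m₁ + m₂)) :
    (X * W m₁ m₂) i j =
      (if (j : ℕ) + 1 = m₁ then (zPow 1 - HahnSeries.C (1 / 2)) * X i ⟨0, by lia⟩ else 0)
        - (if (j : ℕ) + 1 = m₁ + m₂ then HahnSeries.C s * X i ⟨0, by lia⟩ else 0)
        + (if h : (j : ℕ) + 1 < m₁ + m₂ then HahnSeries.C s * X i ⟨j + 1, h⟩ else 0) :=
  mul_companion_apply hm₁ _ _ X i j

include hm₂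

theorem companion_mul_apply_zero (w c : R) (X : Matrix (Fin (m₁ + m₂)) (Fin (m₁ + m₂)) R)
    {i : Fin (m₁ + m₂)} (hi : (i : ℕ) = 0) (j : Fin (m₁ + m₂)) :
    (companion m₁ m₂ w c * X) i j =
      w * X ⟨m₁ - 1, by lia⟩ j - c * X ⟨m₁ + m₂ - 1, by lia⟩ j := by
  rw [companion, add_mul, sub_mul, Matrix.smul_mul, Matrix.smul_mul, Matrix.smul_mul,
    Matrix.add_apply, Matrix.sub_apply, Matrix.smul_apply, Matrix.smul_apply, Matrix.smul_apply,
    elem_mul X (k := ⟨m₁ - 1, by lia⟩) (by simp only; lia),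
    elem_mul X (k := ⟨m₁ + m₂ - 1, by lia⟩) (by simp only; lia), sum_elem_mul,
    if_pos (by lia), if_pos (by lia), dif_neg (by lia), smul_zero, add_zero, smul_eq_mul,
    smul_eq_mul]

theorem companion_mul_apply_pos (w c : R) (X : Matrix (Fin (m₁ + m₂)) (Fin (m₁ + m₂)) R)
    {i : Fin (m₁ + m₂)} (hi : 0 < (i : ℕ)) (j : Fin (m₁ + m₂)) :
    (companion m₁ m₂ w c * X) i j = c * X ⟨i - 1, by lia⟩ j := by
  rw [companion, add_mul, sub_mul, Matrix.smul_mul, Matrix.smul_mul, Matrix.smul_mul,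
    Matrix.add_apply, Matrix.sub_apply, Matrix.smul_apply, Matrix.smul_apply, Matrix.smul_apply,
    elem_mul X (k := ⟨m₁ - 1, by lia⟩) (by simp only; lia),
    elem_mul X (k := ⟨m₁ + m₂ - 1, by lia⟩) (by simp only; lia), sum_elem_mul,
    if_neg (by lia), if_neg (by lia), dif_pos (by lia), smul_zero, smul_zero, sub_zero, zero_add,
    smul_eq_mul]

theorem W_mul_apply_zero (X : Matrix (Fin (m₁ + m₂)) (Fin (m₁ + m₂)) Ser) {i : Fin (m₁ + m₂)}
    (hi : (i : ℕ) = 0) (j : Fin (m₁ + m₂)) :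
    (W m₁ m₂ * X) i j = (zPow 1 - HahnSeries.C (1 / 2)) * X ⟨m₁ - 1, by lia⟩ j
      - HahnSeries.C s * X ⟨m₁ + m₂ - 1, by lia⟩ j :=
  companion_mul_apply_zero hm₁ hm₂ _ _ X hi j

theorem W_mul_apply_pos (X : Matrix (Fin (m₁ + m₂)) (Fin (m₁ + m₂)) Ser) {i : Fin (m₁ + m₂)}
    (hi : 0 < (i : ℕ)) (j : Fin (m₁ + m₂)) :
    (W m₁ m₂ * X) i j = HahnSeries.C s * X ⟨i - 1, by lia⟩ j :=
  companion_mul_apply_pos hm₁ hm₂ _ _ X hi j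

end

/-! ### The equation in terms of doubly indexed series -/

theorem shift_neg (f : Ser) : shift (-f) = -shift f := by
  ext r
  simp only [shift, HahnSeries.coeff_neg, mul_neg]
  rw [finsum_neg_distrib]

theorem shift_sub (f f' : Ser) : shift (f - f') = shift f - shift f' := by
  ext r
  simp only [shift, HahnSeries.coeff_sub, mul_sub]
  exact finsum_sub_distrib (shift_finite f r) (shift_finite f' r)

/-- The matrix whose columns `1, …, m₁` are the columns `1, …, m₁` of `E`, and whose columns
`m₁ + 1, …, m₁ + m₂` are the columns `1 - m₂, …, 0` of `E` with the opposite sign. -/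
def foldMatrix (m₁ m₂ : ℕ) (E : ℤ → ℤ → Ser) : Matrix (Fin (m₁ + m₂)) (Fin (m₁ + m₂)) Ser :=
  Matrix.of fun i j =>
    if (j : ℕ) + 1 ≤ m₁ then E (i + 1) (j + 1) else -E (i + 1) ((j : ℤ) + 1 - m₁ - m₂)

/-- Every matrix arises from some `E`. -/
theorem exists_foldMatrix_eq {m₁ m₂ : ℕ} (M : Matrix (Fin (m₁ + m₂)) (Fin (m₁ + m₂)) Ser) :
    ∃ E, foldMatrix m₁ m₂ E = M := by
  -- Column `j ≤ 0` of `E` is column `j + m₁ + m₂` of the matrix; the remainder modulo `m₁ + m₂`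
  -- gives its index, starting from `0`, for both signs.
  refine ⟨fun i j => if h : 1 ≤ i ∧ i ≤ m₁ + m₂ ∧ 1 - m₂ ≤ j ∧ j ≤ m₁ then
    (if 1 ≤ j then M ⟨(i - 1).toNat, by lia⟩ ⟨((j - 1) % (m₁ + m₂)).toNat, ?_⟩
      else -M ⟨(i - 1).toNat, by lia⟩ ⟨((j - 1) % (m₁ + m₂)).toNat, ?_⟩) else 0, ?_⟩
  · have := Int.emod_lt_of_pos (j - 1) (b := m₁ + m₂) (by lia)
    have := Int.emod_nonneg (j - 1) (b := m₁ + m₂) (by lia)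
    lia
  · have := Int.emod_lt_of_pos (j - 1) (b := m₁ + m₂) (by lia)
    have := Int.emod_nonneg (j - 1) (b := m₁ + m₂) (by lia)
    lia
  · ext1 i j
    rw [foldMatrix, Matrix.of_apply]
    have hi := i.isLt
    have hj := j.isLt
    rcases le_or_gt ((j : ℕ) + 1) m₁ with h | h
    · rw [if_pos h, dif_pos (by lia), if_pos (by lia)]
      congr
      · simp
      · rw [add_sub_cancel_right, Int.emod_eq_of_lt (by lia) (by lia), Int.toNat_natCast]
    · rw [if_neg (by lia), dif_pos (by lia), if_neg (by lia), neg_neg]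
      congr
      · simp
      · rw [show (j : ℤ) + 1 - m₁ - m₂ - 1 = j - (m₁ + m₂) by ring, Int.sub_emod_right,
          Int.emod_eq_of_lt (by lia) (by lia), Int.toNat_natCast]

/-- The difference equation for `foldMatrix m₁ m₂ E`, in terms of `E`. It only involves `E i j` with
`1 ≤ i ≤ m₁ + m₂` and `1 - m₂ ≤ j ≤ m₁`. -/
structure IsUnfolded (m₁ m₂ : ℕ) (E : ℤ → ℤ → Ser) : Prop where
  diag : ∀ i j : ℤ, 1 ≤ i → i < m₁ + m₂ → 1 - m₂ ≤ j → j < m₁ →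
    shift (E (i + 1) (j + 1)) = E i j
  left : ∀ i : ℤ, 1 ≤ i → i < m₁ + m₂ →
    HahnSeries.C s * (E i m₁ + shift (E (i + 1) (1 - m₂))) =
      (zPow 1 - HahnSeries.C (1 / 2)) * shift (E (i + 1) 1)
  right : ∀ j : ℤ, 1 - m₂ ≤ j → j < m₁ →
    HahnSeries.C s * (shift (E 1 (j + 1)) + E (m₁ + m₂) j) =
      (zPow 1 - HahnSeries.C (1 / 2)) * E m₁ j
  corner : (zPow 1 - HahnSeries.C (1 / 2)) * shift (E 1 1) - HahnSeries.C s * shift (E 1 (1 - m₂)) =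
    (zPow 1 - HahnSeries.C (1 / 2)) * E m₁ m₁ - HahnSeries.C s * E (m₁ + m₂) m₁

section

variable {m₁ m₂ : ℕ} (hm₁ : 0 < m₁) (hm₂ : 0 < m₂) (E : ℤ → ℤ → Ser)

theorem foldMatrix_of_le (i : Fin (m₁ + m₂)) {j : Fin (m₁ + m₂)} (h : (j : ℕ) + 1 ≤ m₁) :
    foldMatrix m₁ m₂ E i j = E (i + 1) (j + 1) := by
  rw [foldMatrix, Matrix.of_apply, if_pos h]

theorem foldMatrix_of_lt (i : Fin (m₁ + m₂)) {j : Fin (m₁ + m₂)} (h : m₁ < (j : ℕ) + 1) :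
    foldMatrix m₁ m₂ E i j = -E (i + 1) ((j : ℤ) + 1 - m₁ - m₂) := by
  rw [foldMatrix, Matrix.of_apply, if_neg (by lia)]

include hm₁

theorem shift_foldMatrix_mul_W_of_gt (i : Fin (m₁ + m₂)) {j : Fin (m₁ + m₂)}
    (h : m₁ < (j : ℕ) + 1) :
    ((foldMatrix m₁ m₂ E).map shift * W m₁ m₂) i j =
      -(HahnSeries.C s * shift (E (i + 1) ((j : ℤ) + 1 - m₁ - m₂ + 1))) := by
  rw [mul_W_apply hm₁, if_neg (by lia)]
  by_cases hj : (j : ℕ) + 1 = m₁ + m₂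
  · rw [if_pos hj, dif_neg (by lia), Matrix.map_apply, foldMatrix_of_le _ _ (by simp only; lia),
      zero_sub, add_zero, show (j : ℤ) + 1 - m₁ - m₂ + 1 = 1 by lia]
    simp
  · rw [if_neg hj, dif_pos (by lia), Matrix.map_apply, foldMatrix_of_lt _ _ (by simp only; lia),
      sub_zero, zero_add, shift_neg, mul_neg]
    simp only
    rw [show (((j : ℕ) + 1 : ℕ) : ℤ) + 1 - m₁ - m₂ = (j : ℤ) + 1 - m₁ - m₂ + 1 by lia]

include hm₂

theorem shift_foldMatrix_mul_W_of_lt (i : Fin (m₁ + m₂)) {j : Fin (m₁ + m₂)}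
    (h : (j : ℕ) + 1 < m₁) :
    ((foldMatrix m₁ m₂ E).map shift * W m₁ m₂) i j =
      HahnSeries.C s * shift (E (i + 1) (j + 1 + 1)) := by
  rw [mul_W_apply hm₁, if_neg (by lia), if_neg (by lia), dif_pos (by lia), Matrix.map_apply,
    foldMatrix_of_le _ _ (by simp only; lia), sub_zero, zero_add]
  push_cast
  rfl

theorem shift_foldMatrix_mul_W_of_eq (i : Fin (m₁ + m₂)) {j : Fin (m₁ + m₂)}
    (h : (j : ℕ) + 1 = m₁) :
    ((foldMatrix m₁ m₂ E).map shift * W m₁ m₂) i j =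
      (zPow 1 - HahnSeries.C (1 / 2)) * shift (E (i + 1) 1)
        - HahnSeries.C s * shift (E (i + 1) (1 - m₂)) := by
  rw [mul_W_apply hm₁, if_pos h, if_neg (by lia), dif_pos (by lia), Matrix.map_apply,
    Matrix.map_apply, foldMatrix_of_le _ _ (by simp only; lia),
    foldMatrix_of_lt _ _ (by simp only; lia), shift_neg, sub_zero, mul_neg, ← sub_eq_add_neg]
  simp only
  rw [show (((j : ℕ) + 1 : ℕ) : ℤ) + 1 - m₁ - m₂ = 1 - m₂ by lia]
  simp

/-- The difference equation, entry by entry. The entries in the first row give `right`, those in column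
`m₁` give `left`, the entry in both gives `corner`, and the others give `diag`. -/
theorem foldMatrix_equation_iff :
    (foldMatrix m₁ m₂ E).map shift * W m₁ m₂ = W m₁ m₂ * foldMatrix m₁ m₂ E ↔
      IsUnfolded m₁ m₂ E := by
  have hs : (HahnSeries.C s : Ser) ≠ 0 := HahnSeries.C_ne_zero s_ne_zero
  constructor
  · intro h
    have h' := fun i j => congrFun (congrFun h i) j
    refine ⟨?_, ?_, ?_, ?_⟩
    · intro i j hi1 hi2 hj1 hj2
      rcases lt_or_ge 0 j with hj | hj
      · have := h' ⟨i.toNat, by lia⟩ ⟨(j - 1).toNat, by lia⟩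
        rw [shift_foldMatrix_mul_W_of_lt hm₁ hm₂ _ _ (by simp only; lia),
          W_mul_apply_pos hm₁ hm₂ _ (by simp only; lia), foldMatrix_of_le _ _ (by simp only; lia)]
          at this
        simp only at this
        rw [show ((i.toNat : ℕ) : ℤ) = i by lia, show (((j - 1).toNat : ℕ) : ℤ) = j - 1 by lia,
          show ((i.toNat - 1 : ℕ) : ℤ) + 1 = i by lia, sub_add_cancel] at this
        exact mul_left_cancel₀ hs this
      · have := h' ⟨i.toNat, by lia⟩ ⟨(j + m₁ + m₂ - 1).toNat, by lia⟩
        rw [shift_foldMatrix_mul_W_of_gt hm₁ _ _ (by simp only; lia),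
          W_mul_apply_pos hm₁ hm₂ _ (by simp only; lia), foldMatrix_of_lt _ _ (by simp only; lia)]
          at this
        simp only at this
        rw [show ((i.toNat : ℕ) : ℤ) = i by lia,
          show (((j + m₁ + m₂ - 1).toNat : ℕ) : ℤ) + 1 - m₁ - m₂ = j by lia,
          show ((i.toNat - 1 : ℕ) : ℤ) + 1 = i by lia, mul_neg, neg_inj] at this
        exact mul_left_cancel₀ hs this
    · intro i hi1 hi2
      have := h' ⟨i.toNat, by lia⟩ ⟨m₁ - 1, by lia⟩
      rw [shift_foldMatrix_mul_W_of_eq hm₁ hm₂ _ _ (by simp only; lia),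
        W_mul_apply_pos hm₁ hm₂ _ (by simp only; lia), foldMatrix_of_le _ _ (by simp only; lia)]
        at this
      simp only at this
      rw [show ((i.toNat : ℕ) : ℤ) = i by lia, show ((m₁ - 1 : ℕ) : ℤ) + 1 = m₁ by lia,
        show ((i.toNat - 1 : ℕ) : ℤ) + 1 = i by lia] at this
      linear_combination -this
    · intro j hj1 hj2
      rcases lt_or_ge 0 j with hj | hj
      · have := h' ⟨0, by lia⟩ ⟨(j - 1).toNat, by lia⟩
        rw [shift_foldMatrix_mul_W_of_lt hm₁ hm₂ _ _ (by simp only; lia),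
          W_mul_apply_zero hm₁ hm₂ _ rfl, foldMatrix_of_le _ _ (by simp only; lia),
          foldMatrix_of_le _ _ (by simp only; lia)] at this
        simp only at this
        rw [show (((j - 1).toNat : ℕ) : ℤ) = j - 1 by lia, show ((m₁ - 1 : ℕ) : ℤ) + 1 = m₁ by lia,
          show ((m₁ + m₂ - 1 : ℕ) : ℤ) + 1 = m₁ + m₂ by lia, sub_add_cancel, Nat.cast_zero,
          zero_add] at this
        linear_combination this
      · have := h' ⟨0, by lia⟩ ⟨(j + m₁ + m₂ - 1).toNat, by lia⟩
        rw [shift_foldMatrix_mul_W_of_gt hm₁ _ _ (by simp only; lia),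
          W_mul_apply_zero hm₁ hm₂ _ rfl, foldMatrix_of_lt _ _ (by simp only; lia),
          foldMatrix_of_lt _ _ (by simp only; lia)] at this
        simp only at this
        rw [show (((j + m₁ + m₂ - 1).toNat : ℕ) : ℤ) + 1 - m₁ - m₂ = j by lia,
          show ((m₁ - 1 : ℕ) : ℤ) + 1 = m₁ by lia,
          show ((m₁ + m₂ - 1 : ℕ) : ℤ) + 1 = m₁ + m₂ by lia, Nat.cast_zero, zero_add] at this
        linear_combination -this
    · have := h' ⟨0, by lia⟩ ⟨m₁ - 1, by lia⟩
      rw [shift_foldMatrix_mul_W_of_eq hm₁ hm₂ _ _ (by simp only; lia),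
        W_mul_apply_zero hm₁ hm₂ _ rfl, foldMatrix_of_le _ _ (by simp only; lia),
        foldMatrix_of_le _ _ (by simp only; lia)] at this
      simp only at this
      rwa [show ((m₁ - 1 : ℕ) : ℤ) + 1 = m₁ by lia,
        show ((m₁ + m₂ - 1 : ℕ) : ℤ) + 1 = m₁ + m₂ by lia, Nat.cast_zero, zero_add] at this
  · intro h
    ext1 i j
    have hm : ((m₁ - 1 : ℕ) : ℤ) + 1 = m₁ := by lia
    have hl : ((m₁ + m₂ - 1 : ℕ) : ℤ) + 1 = m₁ + m₂ := by lia
    rcases Nat.eq_zero_or_pos (i : ℕ) with hi | hi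
    · have hi' : (i : ℤ) + 1 = 1 := by lia
      rw [W_mul_apply_zero hm₁ hm₂ _ hi]
      rcases lt_trichotomy ((j : ℕ) + 1) m₁ with hj | hj | hj
      · rw [shift_foldMatrix_mul_W_of_lt hm₁ hm₂ _ _ hj, foldMatrix_of_le _ _ hj.le,
          foldMatrix_of_le _ _ hj.le]
        simp only
        rw [hm, hl, hi']
        linear_combination h.right (j + 1) (by lia) (by lia)
      · rw [shift_foldMatrix_mul_W_of_eq hm₁ hm₂ _ _ hj, foldMatrix_of_le _ _ hj.le,
          foldMatrix_of_le _ _ hj.le]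
        simp only
        rw [hm, hl, hi', show (j : ℤ) + 1 = m₁ by lia]
        exact h.corner
      · rw [shift_foldMatrix_mul_W_of_gt hm₁ _ _ hj, foldMatrix_of_lt _ _ hj,
          foldMatrix_of_lt _ _ hj]
        simp only
        rw [hm, hl, hi']
        linear_combination -h.right ((j : ℤ) + 1 - m₁ - m₂) (by lia) (by lia)
    · have hi' : ((i - 1 : ℕ) : ℤ) + 1 = i := by lia
      rw [W_mul_apply_pos hm₁ hm₂ _ hi]
      rcases lt_trichotomy ((j : ℕ) + 1) m₁ with hj | hj | hj
      · rw [shift_foldMatrix_mul_W_of_lt hm₁ hm₂ _ _ hj, foldMatrix_of_le _ _ hj.le]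
        simp only
        rw [hi', h.diag i (j + 1) (by lia) (by lia) (by lia) (by lia)]
      · rw [shift_foldMatrix_mul_W_of_eq hm₁ hm₂ _ _ hj, foldMatrix_of_le _ _ hj.le]
        simp only
        rw [hi', show (j : ℤ) + 1 = m₁ by lia]
        linear_combination -h.left i (by lia) (by lia)
      · rw [shift_foldMatrix_mul_W_of_gt hm₁ _ _ hj, foldMatrix_of_lt _ _ hj]
        simp only
        rw [hi', h.diag i ((j : ℤ) + 1 - m₁ - m₂) (by lia) (by lia) (by lia) (by lia), mul_neg]

end

/-! ### Uniqueness -/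

/-- The coefficients of `f` at `ρ - 1, ρ - 2, …` vanish. -/
def VanishesBelow (f : Ser) (ρ : ℚ) : Prop := ∀ k : ℕ, f.coeff (ρ - (k + 1)) = 0

section

variable {f : Ser} {ρ : ℚ}

theorem VanishesBelow.coeff_sub_one (hf : VanishesBelow f ρ) : f.coeff (ρ - 1) = 0 := by
  simpa using hf 0

theorem VanishesBelow.add_one (hf : VanishesBelow f ρ) (h0 : f.coeff ρ = 0) :
    VanishesBelow f (ρ + 1) := by
  intro k
  cases k with
  | zero => simpa using h0
  | succ k =>
    rw [show ρ + 1 - (((k + 1 : ℕ) : ℚ) + 1) = ρ - (k + 1) by push_cast; ring]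
    exact hf k

theorem VanishesBelow.shift (hf : VanishesBelow f ρ) : VanishesBelow (shift f) ρ := by
  intro n
  refine (finsum_congr fun k => ?_).trans finsum_zero
  rw [show ρ - ((n : ℚ) + 1) - k = ρ - (((n + k : ℕ) : ℚ) + 1) by push_cast; ring, hf, mul_zero]

theorem VanishesBelow.coeff_shift (hf : VanishesBelow f ρ) :
    (TDE.shift f).coeff ρ = f.coeff ρ := by
  refine (finsum_eq_single _ 0 fun k hk => ?_).trans ?_
  · obtain ⟨k, rfl⟩ := Nat.exists_eq_succ_of_ne_zero hk
    rw [Nat.succ_eq_add_one, Nat.cast_add_one, hf k, mul_zero]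
  · simp

/-- `(z - 1) ^ (-ρ) = z ^ (-ρ) (1 + ρ z⁻¹ + O(z⁻²))`. -/
theorem VanishesBelow.coeff_shift_add_one (hf : VanishesBelow f ρ) :
    (TDE.shift f).coeff (ρ + 1) = f.coeff (ρ + 1) + (ρ : Coef) * f.coeff ρ := by
  refine (finsum_eq_sum_of_support_subset (s := {0, 1}) _ fun k hk => ?_).trans ?_
  · by_contra h
    obtain ⟨k, rfl⟩ : ∃ n : ℕ, k = n + 2 := by
      simp only [Finset.coe_insert, Finset.coe_singleton, Set.mem_insert_iff,
        Set.mem_singleton_iff] at h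
      exact ⟨k - 2, by lia⟩
    refine hk ?_
    simp only
    rw [show ρ + 1 - ((k + 2 : ℕ) : ℚ) = ρ - (k + 1) by push_cast; ring, hf, mul_zero]
  · rw [Finset.sum_pair zero_ne_one]
    simp

end

/-- The leading coefficients of the iterated shifts of a series. -/
theorem coeff_of_shift_eq {ρ : ℚ} (f : ℕ → Ser) (n : ℕ) (h : ∀ k < n, shift (f (k + 1)) = f k)
    (hf : VanishesBelow (f n) ρ) :
    (f 0).coeff ρ = (f n).coeff ρ ∧
      (f 0).coeff (ρ + 1) = (f n).coeff (ρ + 1) + n * ((ρ : Coef) * (f n).coeff ρ) := by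
  induction n with
  | zero => simp
  | succ n ih =>
    have h1 := h n n.lt_succ_self
    have h2 : VanishesBelow (f n) ρ := h1 ▸ hf.shift
    obtain ⟨h3, h4⟩ := ih (fun k hk => h k (by lia)) h2
    rw [h3, h4, ← h1, hf.coeff_shift, hf.coeff_shift_add_one]
    refine ⟨rfl, ?_⟩
    push_cast
    ring

theorem coeff_zPow_one_sub_C_half_mul (f : Ser) (r : ℚ) :
    ((zPow 1 - HahnSeries.C (1 / 2)) * f).coeff r = f.coeff (r + 1) - 1 / 2 * f.coeff r := by
  rw [sub_mul, HahnSeries.coeff_sub, coeff_zPow_mul, HahnSeries.C_mul_eq_smul,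
    HahnSeries.coeff_smul, smul_eq_mul]

theorem coeff_C_mul (x : Coef) (f : Ser) (r : ℚ) : (HahnSeries.C x * f).coeff r = x * f.coeff r := by
  rw [HahnSeries.C_mul_eq_smul, HahnSeries.coeff_smul, smul_eq_mul]

/-- The range of indices relevant for `foldMatrix m₁ m₂ E`. -/
def window (m₁ m₂ : ℕ) : Finset (ℤ × ℤ) :=
  Finset.Icc 1 ((m₁ : ℤ) + m₂) ×ˢ Finset.Icc (1 - (m₂ : ℤ)) m₁

theorem mem_window {m₁ m₂ : ℕ} {i j : ℤ} :
    (i, j) ∈ window m₁ m₂ ↔ (1 ≤ i ∧ i ≤ m₁ + m₂) ∧ 1 - m₂ ≤ j ∧ j ≤ m₁ := by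
  rw [window, Finset.mem_product, Finset.mem_Icc, Finset.mem_Icc]

namespace IsUnfolded

variable {m₁ m₂ : ℕ} {E : ℤ → ℤ → Ser}

/-- Along a diagonal, the leading coefficient is constant and the next one is an affine function. -/
theorem coeff_diag (h : IsUnfolded m₁ m₂ E) {i j i' j' : ℤ} (hij : (i, j) ∈ window m₁ m₂)
    (hij' : (i', j') ∈ window m₁ m₂) (hd : j - i = j' - i') {ρ : ℚ}
    (hE : VanishesBelow (E i j) ρ) (hE' : VanishesBelow (E i' j') ρ) :
    (E i j).coeff ρ = (E i' j').coeff ρ ∧ (E i j).coeff (ρ + 1) = (E i' j').coeff (ρ + 1) +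
      ((i' - i : ℤ) : Coef) * ((ρ : Coef) * (E i' j').coeff ρ) := by
  wlog hle : i ≤ i' generalizing i j i' j'
  · obtain ⟨h1, h2⟩ := this hij' hij hd.symm hE' hE (by lia)
    refine ⟨h1.symm, ?_⟩
    rw [h2, h1]
    push_cast
    ring
  rw [mem_window] at hij hij'
  obtain ⟨n, rfl⟩ : ∃ n : ℕ, i' = i + n := ⟨(i' - i).toNat, by lia⟩
  obtain rfl : j' = j + n := by lia
  have := coeff_of_shift_eq (ρ := ρ) (fun k : ℕ => E (i + k) (j + k)) n (fun k hk => ?_) hE'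
  · simp only [Nat.cast_zero, add_zero] at this
    rw [add_sub_cancel_left, Int.cast_natCast]
    exact this
  · push_cast
    rw [← add_assoc, ← add_assoc]
    exact h.diag _ _ (by lia) (by lia) (by lia) (by lia)

variable (hm₁ : 0 < m₁) (hm₂ : 0 < m₂) (h : IsUnfolded m₁ m₂ E) {ρ : ℚ}
  (hlow : ∀ i j, (i, j) ∈ window m₁ m₂ → VanishesBelow (E i j) ρ)
include h hlow

theorem coeff_eq_of_sub_eq {i j i' j' : ℤ} (hij : (i, j) ∈ window m₁ m₂)
    (hij' : (i', j') ∈ window m₁ m₂) (hd : j - i = j' - i') :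
    (E i j).coeff ρ = (E i' j').coeff ρ :=
  (h.coeff_diag hij hij' hd (hlow _ _ hij) (hlow _ _ hij')).1

include hm₁ hm₂

/-- The leading coefficients vanish on the first column. -/
theorem coeff_col_one (hρ : 0 < ρ) (i : ℤ) (hi1 : 1 ≤ i) (hi2 : i ≤ m₁ + m₂) :
    (E i 1).coeff ρ = 0 := by
  rcases hi1.eq_or_lt with rfl | hi
  · -- In the corner equation the terms with `s` cancel to leading order. The others compare
    -- `shift (E 1 1)` with `E m₁ m₁`, of which it is the `m₁`-fold shift, whence a factor `m₁ ρ`.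
    have h1 := congrArg (fun f : Ser => f.coeff ρ) h.corner
    have w1 : (1, 1) ∈ window m₁ m₂ := mem_window.2 (by lia)
    have w2 : (1, 1 - (m₂ : ℤ)) ∈ window m₁ m₂ := mem_window.2 (by lia)
    have w3 : ((m₁ : ℤ), (m₁ : ℤ)) ∈ window m₁ m₂ := mem_window.2 (by lia)
    have w4 : ((m₁ : ℤ) + m₂, (m₁ : ℤ)) ∈ window m₁ m₂ := mem_window.2 (by lia)
    simp only [HahnSeries.coeff_sub, coeff_zPow_one_sub_C_half_mul, coeff_C_mul] at h1
    rw [(hlow _ _ w1).coeff_shift_add_one, (hlow _ _ w1).coeff_shift,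
      (hlow _ _ w2).coeff_shift, h.coeff_eq_of_sub_eq hlow w4 w2 (by lia)] at h1
    obtain ⟨h2, h3⟩ := h.coeff_diag w3 w1 (by lia) (hlow _ _ w3) (hlow _ _ w1)
    rw [h2, h3] at h1
    push_cast at h1
    have h4 : (m₁ : Coef) * (ρ : Coef) * (E 1 1).coeff ρ = 0 := by linear_combination h1
    have h5 : (m₁ : Coef) ≠ 0 := by exact_mod_cast hm₁.ne'
    have h6 : (ρ : Coef) ≠ 0 := by exact_mod_cast hρ.ne'
    simpa [h5, h6] using h4
  · -- The factor `z` raises the order of one term of `left` above that of the others.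
    have h1 := congrArg (fun f : Ser => f.coeff (ρ - 1)) (h.left (i - 1) (by lia) (by lia))
    have w1 : (i, 1) ∈ window m₁ m₂ := mem_window.2 (by lia)
    have w2 : (i, 1 - (m₂ : ℤ)) ∈ window m₁ m₂ := mem_window.2 (by lia)
    have w3 : (i - 1, (m₁ : ℤ)) ∈ window m₁ m₂ := mem_window.2 (by lia)
    simp only [HahnSeries.coeff_add, coeff_zPow_one_sub_C_half_mul, coeff_C_mul,
      sub_add_cancel] at h1
    rw [(hlow _ _ w1).coeff_shift, (hlow _ _ w1).shift.coeff_sub_one,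
      (hlow _ _ w2).shift.coeff_sub_one, (hlow _ _ w3).coeff_sub_one] at h1
    linear_combination -h1

/-- The leading coefficients vanish on all diagonals that meet the first column. -/
theorem coeff_eq_zero_of_le (hρ : 0 < ρ) {i j : ℤ} (hij : (i, j) ∈ window m₁ m₂) (hle : j ≤ i)
    (hlt : i < j + (m₁ + m₂)) : (E i j).coeff ρ = 0 := by
  rw [h.coeff_eq_of_sub_eq hlow hij (i' := i - j + 1) (j' := 1)
    (mem_window.2 (by rw [mem_window] at hij; lia)) (by lia)]
  exact h.coeff_col_one hm₁ hm₂ hlow hρ _ (by lia) (by lia)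

/-- A linear relation between the leading coefficients on the diagonals `j - i = m₁ - k` and
`j - i = m₁ - k - l`, obtained by eliminating the two subleading coefficients. -/
theorem coeff_relation (hρ : 0 < ρ) (k : ℤ) (hk1 : 1 ≤ k) (hk2 : k < m₁ + m₂) :
    ((m₁ * ρ + (m₁ - k) : ℚ) : Coef) * (E k m₁).coeff ρ +
      ((m₁ - k - m₂ * ρ : ℚ) : Coef) * (E (m₁ + m₂) (m₁ - k)).coeff ρ = 0 := by
  have w1 : (k + 1, 1) ∈ window m₁ m₂ := mem_window.2 (by lia)
  have w2 : (k + 1, 1 - (m₂ : ℤ)) ∈ window m₁ m₂ := mem_window.2 (by lia)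
  have w3 : (k, (m₁ : ℤ)) ∈ window m₁ m₂ := mem_window.2 (by lia)
  have w4 : (1, (m₁ - k + 1 : ℤ)) ∈ window m₁ m₂ := mem_window.2 (by lia)
  have w5 : ((m₁ + m₂ : ℤ), (m₁ - k : ℤ)) ∈ window m₁ m₂ := mem_window.2 (by lia)
  have w6 : ((m₁ : ℤ), (m₁ - k : ℤ)) ∈ window m₁ m₂ := mem_window.2 (by lia)
  have hz1 := h.coeff_col_one hm₁ hm₂ hlow hρ (k + 1) (by lia) (by lia)
  have hz6 : (E m₁ (m₁ - k)).coeff ρ = 0 := by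
    rw [h.coeff_eq_of_sub_eq hlow w6 w1 (by lia), hz1]
  -- On the diagonal `j - i = -k` the leading coefficients vanish, so that `coeff_diag` applies there
  -- with `ρ + 1` in place of `ρ`.
  have v1 := (hlow _ _ w1).add_one hz1
  have v6 := (hlow _ _ w6).add_one hz6
  have hL := h.left k hk1 hk2
  have hR := h.right (m₁ - k) (by lia) (by lia)
  have hL0 := congrArg (fun f : Ser => f.coeff ρ) hL
  have hL1 := congrArg (fun f : Ser => f.coeff (ρ + 1)) hL
  have hR1 := congrArg (fun f : Ser => f.coeff (ρ + 1)) hR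
  simp only [HahnSeries.coeff_add, coeff_zPow_one_sub_C_half_mul, coeff_C_mul] at hL0 hL1 hR1
  rw [(hlow _ _ w2).coeff_shift, (hlow _ _ w1).coeff_shift, v1.coeff_shift, hz1] at hL0
  rw [(hlow _ _ w2).coeff_shift_add_one, v1.coeff_shift, v1.coeff_shift_add_one] at hL1
  rw [(hlow _ _ w4).coeff_shift_add_one] at hR1
  obtain ⟨d1, d2⟩ := h.coeff_diag w3 w4 (by lia) (hlow _ _ w3) (hlow _ _ w4)
  obtain ⟨d3, d4⟩ := h.coeff_diag w2 w5 (by lia) (hlow _ _ w2) (hlow _ _ w5)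
  obtain ⟨d5, d6⟩ := h.coeff_diag w1 w6 (by lia) v1 v6
  rw [d5, d3] at hL0
  rw [d2, d4, d3, d5, d6] at hL1
  rw [d1] at hL0 ⊢
  -- `hL0` expresses the coefficient at `ρ + 1` on this diagonal; the difference of `hL1` and `hR1`
  -- contains no coefficients at `ρ + 1` on the other two diagonals.
  apply mul_left_cancel₀ s_ne_zero
  push_cast at hL0 hL1 hR1 ⊢
  linear_combination (m₁ - k) * (ρ + 1) * hL0 - hL1 + hR1

/-- The coefficients at the least exponent `ρ` vanish if `ρ > 0`. In `coeff_relation` one of the two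
unknowns lies on a diagonal that meets the first column, and the factor of the other is nonzero. -/
theorem coeff_eq_zero (hρ : 0 < ρ) {i j : ℤ} (hij : (i, j) ∈ window m₁ m₂) :
    (E i j).coeff ρ = 0 := by
  have hw := mem_window.1 hij
  have key := h.coeff_relation hm₁ hm₂ hlow hρ
  have hm₁' : (0 : ℚ) < m₁ := by exact_mod_cast hm₁
  have hm₂' : (0 : ℚ) < m₂ := by exact_mod_cast hm₂
  rcases le_or_gt j i with hle | hlt
  · rcases lt_or_ge i (j + (m₁ + m₂)) with hlt' | hge
    · exact h.coeff_eq_zero_of_le hm₁ hm₂ hlow hρ hij hle hlt'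
    · obtain ⟨k, hk⟩ : ∃ k : ℤ, k = i - j - m₂ := ⟨_, rfl⟩
      have hk0 : (m₁ : ℚ) ≤ k := by exact_mod_cast (by lia : (m₁ : ℤ) ≤ k)
      have h1 := key k (by lia) (by lia)
      rw [h.coeff_eq_zero_of_le hm₁ hm₂ hlow hρ (mem_window.2 (by lia)) (by lia) (by lia),
        mul_zero, zero_add] at h1
      rw [h.coeff_eq_of_sub_eq hlow hij (i' := m₁ + m₂) (j' := m₁ - k)
        (mem_window.2 (by lia)) (by lia)]
      refine (mul_eq_zero.1 h1).resolve_left (Rat.cast_ne_zero.2 (ne_of_lt ?_))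
      nlinarith
  · obtain ⟨k, hk⟩ : ∃ k : ℤ, k = m₁ - (j - i) := ⟨_, rfl⟩
    have hk0 : (k : ℚ) ≤ m₁ := by exact_mod_cast (by lia : k ≤ (m₁ : ℤ))
    have h1 := key k (by lia) (by lia)
    rw [h.coeff_eq_zero_of_le hm₁ hm₂ hlow hρ (i := m₁ + m₂) (mem_window.2 (by lia)) (by lia)
      (by lia), mul_zero, add_zero] at h1
    rw [h.coeff_eq_of_sub_eq hlow hij (i' := k) (j' := m₁)
      (mem_window.2 (by lia)) (by lia)]
    refine (mul_eq_zero.1 h1).resolve_left (Rat.cast_ne_zero.2 (ne_of_gt ?_))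
    nlinarith

end IsUnfolded

/-- A solution all of whose entries are of the form `o(1)` vanishes. -/
theorem IsUnfolded.eq_zero {m₁ m₂ : ℕ} {E : ℤ → ℤ → Ser} (hm₁ : 0 < m₁) (hm₂ : 0 < m₂)
    (h : IsUnfolded m₁ m₂ E)
    (hpos : ∀ i j, (i, j) ∈ window m₁ m₂ → ∀ r ≤ 0, (E i j).coeff r = 0) {i j : ℤ}
    (hij : (i, j) ∈ window m₁ m₂) : E i j = 0 := by
  by_contra hne
  set S : Set ℚ := ⋃ p ∈ window m₁ m₂, (E p.1 p.2).support with hS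
  have hWF : S.IsWF :=
    ((Finset.isPWO_bUnion _).2 fun p _ => (E p.1 p.2).isPWO_support).isWF
  have hSne : S.Nonempty := by
    obtain ⟨r, hr⟩ := HahnSeries.support_nonempty_iff.2 hne
    exact ⟨r, Set.mem_biUnion (x := (i, j)) hij hr⟩
  obtain ⟨p, hp, hmem⟩ := Set.mem_iUnion₂.1 (hWF.min_mem hSne)
  have hlow : ∀ i j, (i, j) ∈ window m₁ m₂ → VanishesBelow (E i j) (hWF.min hSne) := by
    intro i j hij k
    by_contra hk
    have h1 : hWF.min hSne ≤ hWF.min hSne - (k + 1) :=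
      hWF.min_le hSne (Set.mem_biUnion (x := (i, j)) hij hk)
    have : (0 : ℚ) ≤ k := k.cast_nonneg
    linarith
  have hρ : 0 < hWF.min hSne := by
    by_contra hle
    exact hmem (hpos _ _ hp _ (not_lt.1 hle))
  exact hmem (h.coeff_eq_zero hm₁ hm₂ hlow hρ hp)

/-! ### Existence -/

section

variable {m₁ m₂ : ℕ} (hm₁ : 0 < m₁) (hm₂ : 0 < m₂) (a : ℕ)

/-- The extension of the series `g_a(z, i, j)` to arbitrary integers `i` and `j`. Exchanging `m₁` and
`m₂`, `a` and `l - a`, and `i` and `j` up to translation, reduces `a > m₁` to the other case. -/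
def solutionEntry (i j : ℤ) : Ser :=
  if a ≤ m₁ then extSer hm₁ hm₂ a i j else extSer hm₂ hm₁ (m₁ + m₂ - a) (j + m₂) (i - m₁)

theorem shift_solutionEntry (i j : ℤ) :
    shift (solutionEntry hm₁ hm₂ a (i + 1) (j + 1)) = solutionEntry hm₁ hm₂ a i j := by
  simp only [solutionEntry]
  split_ifs
  · exact shift_extSer hm₁ hm₂ a i j
  · rw [add_right_comm j, add_sub_right_comm i]
    exact shift_extSer hm₂ hm₁ _ _ _

theorem solutionEntry_add_left (i j : ℤ) :
    HahnSeries.C s * (solutionEntry hm₁ hm₂ a i (j + m₁) + solutionEntry hm₁ hm₂ a i (j - m₂)) =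
      (zPow 1 + HahnSeries.C ((j - 1 / 2 : ℚ) : Coef)) * solutionEntry hm₁ hm₂ a i j := by
  simp only [solutionEntry]
  split_ifs
  · exact extSer_add_left hm₁ hm₂ a i j
  · have := extSer_add_right hm₂ hm₁ (m₁ + m₂ - a) (j + m₂) (i - m₁)
    rw [show ((j + m₂ : ℤ) : ℚ) - m₂ - 1 / 2 = j - 1 / 2 by push_cast; ring] at this
    rw [← this, add_sub_cancel_right, sub_add_cancel, add_right_comm, add_comm (extSer _ _ _ j _)]

theorem solutionEntry_add_right (i j : ℤ) :
    HahnSeries.C s * (solutionEntry hm₁ hm₂ a (i - m₁) j + solutionEntry hm₁ hm₂ a (i + m₂) j) =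
      (zPow 1 + HahnSeries.C ((i - m₁ - 1 / 2 : ℚ) : Coef)) * solutionEntry hm₁ hm₂ a i j := by
  simp only [solutionEntry]
  split_ifs
  · exact extSer_add_right hm₁ hm₂ a i j
  · have := extSer_add_left hm₂ hm₁ (m₁ + m₂ - a) (j + m₂) (i - m₁)
    rw [show ((i - m₁ : ℤ) : ℚ) - 1 / 2 = i - m₁ - 1 / 2 by push_cast; ring] at this
    rw [← this, add_sub_right_comm, add_comm (extSer _ _ _ _ (i - m₁ - m₁))]

/-- Both kinds of boundary equations are three-term relations, after replacing `shift (E i j)` by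
`E (i - 1) (j - 1)`; the corner equation is the difference of two of them. -/
theorem isUnfolded_solutionEntry : IsUnfolded m₁ m₂ (solutionEntry hm₁ hm₂ a) := by
  have hA := shift_solutionEntry hm₁ hm₂ a
  have hL : ∀ i : ℤ, HahnSeries.C s * (solutionEntry hm₁ hm₂ a i m₁ +
      solutionEntry hm₁ hm₂ a i (-m₂)) =
      (zPow 1 - HahnSeries.C (1 / 2)) * solutionEntry hm₁ hm₂ a i 0 := by
    intro i
    have := solutionEntry_add_left hm₁ hm₂ a i 0
    rw [zero_add, zero_sub] at this
    rw [this, show (((0 : ℤ) - 1 / 2 : ℚ) : Coef) = -(1 / 2) by push_cast; ring, map_neg,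
      ← sub_eq_add_neg]
  have hR : ∀ j : ℤ, HahnSeries.C s * (solutionEntry hm₁ hm₂ a 0 j +
      solutionEntry hm₁ hm₂ a (m₁ + m₂) j) =
      (zPow 1 - HahnSeries.C (1 / 2)) * solutionEntry hm₁ hm₂ a m₁ j := by
    intro j
    have := solutionEntry_add_right hm₁ hm₂ a m₁ j
    rw [sub_self] at this
    rw [this, show ((((m₁ : ℤ) : ℚ) - m₁ - 1 / 2 : ℚ) : Coef) = -(1 / 2) by push_cast; ring,
      map_neg, ← sub_eq_add_neg]
  have h1 : ∀ i : ℤ, shift (solutionEntry hm₁ hm₂ a (i + 1) 1) = solutionEntry hm₁ hm₂ a i 0 :=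
    fun i => hA i 0
  have h2 : ∀ i : ℤ, shift (solutionEntry hm₁ hm₂ a (i + 1) (1 - m₂)) =
      solutionEntry hm₁ hm₂ a i (-m₂) := by
    intro i
    rw [← hA i (-m₂), neg_add_eq_sub]
  have h3 : ∀ j : ℤ, shift (solutionEntry hm₁ hm₂ a 1 (j + 1)) = solutionEntry hm₁ hm₂ a 0 j :=
    fun j => hA 0 j
  refine ⟨fun i j _ _ _ _ => hA i j, fun i _ _ => ?_, fun j _ _ => ?_, ?_⟩
  · rw [h1, h2, hL]
  · rw [h3, hR]
  · have h4 := h1 0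
    have h5 := h2 0
    rw [zero_add] at h4 h5
    rw [h4, h5]
    linear_combination hR m₁ - hL 0

/-- The coefficient of `z ^ (1 - q_a)` in the entry `(i, j)`. -/
def leadingCoeff (m₁ m₂ a : ℕ) (i j : ℤ) : Coef :=
  if a ≤ m₁ then (if j - i = m₁ - a then 1 else 0) else (if i - j = a + m₂ then 1 else 0)

variable {a} {i j : ℤ} (hij : (i, j) ∈ window m₁ m₂) (ha : a ≤ m₁ + m₂)
include hm₁ hm₂ hij ha

theorem solutionEntry_eq_g :
    solutionEntry hm₁ hm₂ a i j = g m₁ m₂ a i j := by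
  rw [mem_window] at hij
  have key : ∀ (F : LaurentSeries Coef) (c : ℤ → Coef), (∀ n < -1, F.coeff n = 0) →
      (∀ n, F.coeff n = c n) → F = laurentFromNegOne c := by
    intro F c h1 h2
    ext n
    refine Eq.trans ?_ (congrFun HahnSeries.coeff_ofSuppBddBelow n).symm
    rw [← h2]
    split_ifs with h
    · rfl
    · exact h1 n (not_le.1 h)
  rw [solutionEntry, g, q]
  split_ifs with h
  · have hw : (a : ℤ) + j - i < 2 * m₁ := by lia
    rw [extSer]
    congr 2
    refine key _ _ (fun n hn => ?_) fun n => ?_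
    · rw [coeff_extLaurent, extCoeff_eq_sum_Icc hm₁ hm₂ a hw, Finset.Icc_eq_empty (not_le.2 hn),
        Finset.sum_empty]
    · rw [coeff_extLaurent, extCoeff_eq_gCoeffLow hm₁ hm₂ a hw]
  · have hw : ((m₁ + m₂ - a : ℕ) : ℤ) + (i - m₁) - (j + m₂) < 2 * m₂ := by lia
    rw [extSer, show ((m₁ + m₂ - a : ℕ) : ℚ) = m₁ + m₂ - a by push_cast [Nat.cast_sub ha]; ring]
    congr 2
    refine key _ _ (fun n hn => ?_) fun n => ?_
    · rw [coeff_extLaurent, extCoeff_eq_sum_Icc hm₂ hm₁ _ hw, Finset.Icc_eq_empty (not_le.2 hn),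
        Finset.sum_empty]
    · rw [coeff_extLaurent, extCoeff_eq_gCoeffLow hm₂ hm₁ _ hw, gCoeffHigh_eq_gCoeffLow ha]

theorem exists_g_eq :
    ∃ N : LaurentSeries Coef, g m₁ m₂ a i j = zPow (1 - q m₁ m₂ a) * ofLaurent N ∧
      ∀ n ≤ 0, N.coeff n = if n = 0 then leadingCoeff m₁ m₂ a i j else 0 := by
  rw [mem_window] at hij
  have hz : zPow (1 - q m₁ m₂ a) = zPow (-q m₁ m₂ a) * zPow 1 := by
    rw [zPow, zPow, zPow, HahnSeries.single_mul_single, one_mul,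
      show -(1 - q m₁ m₂ a) = -(-q m₁ m₂ a) + -1 by ring]
  have hz1 : ofLaurent (HahnSeries.single 1 1) * zPow 1 = 1 := by
    have := ofLaurent_single 1
    rw [Int.cast_one] at this
    rw [← this, ← map_mul, HahnSeries.single_mul_single, one_mul, add_neg_cancel]
    exact map_one ofLaurent
  refine ⟨HahnSeries.single 1 1 * laurentFromNegOne
      (if a ≤ m₁ then gCoeffLow m₁ m₂ a i j else gCoeffHigh m₁ m₂ a i j), ?_, ?_⟩
  · rw [g, map_mul, hz]
    linear_combination -zPow (-q m₁ m₂ a) * ofLaurent (laurentFromNegOne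
      (if a ≤ m₁ then gCoeffLow m₁ m₂ a i j else gCoeffHigh m₁ m₂ a i j)) * hz1
  · intro n hn
    rw [HahnSeries.coeff_single_mul, one_mul]
    refine (congrFun HahnSeries.coeff_ofSuppBddBelow (n - 1)).trans ?_
    rcases hn.eq_or_lt with rfl | hn
    · rw [if_pos (by lia), if_pos rfl, leadingCoeff, zero_sub]
      by_cases h : a ≤ m₁
      · have hw : (a : ℤ) + j - i < 2 * m₁ := by lia
        rw [if_pos h, if_pos h, ← extCoeff_eq_gCoeffLow hm₁ hm₂ a hw,
          extCoeff_neg_one hm₁ hm₂ a hw]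
      · have hw : ((m₁ + m₂ - a : ℕ) : ℤ) + (i - m₁) - (j + m₂) < 2 * m₂ := by lia
        rw [if_neg h, if_neg h, gCoeffHigh_eq_gCoeffLow ha,
          ← extCoeff_eq_gCoeffLow hm₂ hm₁ _ hw,
          extCoeff_neg_one hm₂ hm₁ _ hw]
        congr 1
        apply propext
        lia
    · rw [if_neg (by lia), if_neg (by lia)]

end

/-- Column indices `j ≤ 0` contribute to the case `a > m₁` only, and column indices `j ≥ 1` to the case
`a ≤ m₁` only. -/
theorem K_apply {m₁ m₂ a : ℕ} (hm₁ : 0 < m₁) (hm₂ : 0 < m₂) (i j : Fin (m₁ + m₂)) :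
    K m₁ m₂ a i j = if (j : ℕ) + 1 ≤ m₁ then leadingCoeff m₁ m₂ a (i + 1) (j + 1)
      else -leadingCoeff m₁ m₂ a (i + 1) ((j : ℤ) + 1 - m₁ - m₂) := by
  have hi := i.isLt
  have hj := j.isLt
  rw [K]
  simp only [leadingCoeff]
  by_cases ha : a ≤ m₁
  · rw [if_pos ha, if_pos ha, if_pos ha, Matrix.sum_apply, Finset.sum_congr rfl
      (g := fun t : ℕ => if t = (i : ℕ) + 1 then
        (if (j : ℕ) + 1 = m₁ - a + (i + 1) then (1 : Coef) else 0) else 0), Finset.sum_ite_eq']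
    · grind
    · intro t ht
      rw [Finset.mem_Icc] at ht
      simp only [elem, Matrix.of_apply]
      grind
  · rw [if_neg ha, if_neg ha, if_neg ha, Matrix.neg_apply, Matrix.sum_apply, Finset.sum_congr rfl
      (g := fun t : ℕ => if t = (j : ℕ) + 1 - m₁ then
        (if (i : ℕ) + m₁ = a + j ∧ m₁ < (j : ℕ) + 1 then (1 : Coef) else 0) else 0),
      Finset.sum_ite_eq']
    · grind
    · intro t ht
      rw [Finset.mem_Icc] at ht
      simp only [elem, Matrix.of_apply]
      grind

theorem isSolution_foldMatrix {m₁ m₂ a : ℕ} (hm₁ : 0 < m₁) (hm₂ : 0 < m₂) (ha : a ≤ m₁ + m₂) :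
    IsSolution m₁ m₂ a (foldMatrix m₁ m₂ (g m₁ m₂ a)) := by
  have hi : ∀ i : Fin (m₁ + m₂), (1 : ℤ) ≤ i + 1 ∧ (i : ℤ) + 1 ≤ m₁ + m₂ := by
    intro i
    have := i.isLt
    lia
  have heq : foldMatrix m₁ m₂ (g m₁ m₂ a) = foldMatrix m₁ m₂ (solutionEntry hm₁ hm₂ a) := by
    ext1 i j
    have := j.isLt
    rcases le_or_gt ((j : ℕ) + 1) m₁ with h | h
    · rw [foldMatrix_of_le _ _ h, foldMatrix_of_le _ _ h,
        solutionEntry_eq_g hm₁ hm₂ (mem_window.2 (by have := hi i; lia)) ha]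
    · rw [foldMatrix_of_lt _ _ h, foldMatrix_of_lt _ _ h,
        solutionEntry_eq_g hm₁ hm₂ (mem_window.2 (by have := hi i; lia)) ha]
  refine ⟨?_, ?_⟩
  · rw [heq, foldMatrix_equation_iff hm₁ hm₂]
    exact isUnfolded_solutionEntry hm₁ hm₂ a
  · have hN : ∀ i j : Fin (m₁ + m₂), ∃ N : LaurentSeries Coef,
        foldMatrix m₁ m₂ (g m₁ m₂ a) i j = zPow (1 - q m₁ m₂ a) * ofLaurent N ∧
        ∀ n ≤ 0, N.coeff n = if n = 0 then K m₁ m₂ a i j else 0 := by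
      intro i j
      have := j.isLt
      rw [K_apply hm₁ hm₂]
      rcases le_or_gt ((j : ℕ) + 1) m₁ with h | h
      · rw [foldMatrix_of_le _ _ h, if_pos h]
        exact exists_g_eq hm₁ hm₂ (mem_window.2 (by have := hi i; lia)) ha
      · obtain ⟨N, h1, h2⟩ := exists_g_eq hm₁ hm₂ (i := (i : ℤ) + 1)
          (j := (j : ℤ) + 1 - m₁ - m₂) (mem_window.2 (by have := hi i; lia)) ha
        rw [foldMatrix_of_lt _ _ h, if_neg (by lia)]
        refine ⟨-N, ?_, fun n hn => ?_⟩
        · rw [h1, map_neg]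
          exact (mul_neg (zPow (1 - q m₁ m₂ a)) (ofLaurent N)).symm
        · rw [HahnSeries.coeff_neg, h2 n hn]
          split_ifs <;> simp
    choose N hN1 hN2 using hN
    refine ⟨Matrix.of N, ?_, hN2⟩
    ext1 i j
    exact hN1 i j

theorem q_pos {m₁ m₂ a : ℕ} (hm₁ : 0 < m₁) (hm₂ : 0 < m₂) (ha : 1 ≤ a) (hal : a < m₁ + m₂) :
    0 < q m₁ m₂ a := by
  rw [q]
  split_ifs
  · positivity
  · have : (a : ℚ) < m₁ + m₂ := by exact_mod_cast hal
    exact div_pos (by linarith) (by positivity)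

/-- The difference of two solutions has only exponents at most `-q_a < 0` of `z`, hence vanishes. -/
theorem IsSolution.unique {m₁ m₂ a : ℕ} (hm₁ : 0 < m₁) (hm₂ : 0 < m₂) (ha : 1 ≤ a)
    (hal : a < m₁ + m₂) {M M' : Matrix (Fin (m₁ + m₂)) (Fin (m₁ + m₂)) Ser}
    (h : IsSolution m₁ m₂ a M) (h' : IsSolution m₁ m₂ a M') : M = M' := by
  obtain ⟨E, hE⟩ := exists_foldMatrix_eq (M - M')
  have hU : IsUnfolded m₁ m₂ E := by
    rw [← foldMatrix_equation_iff hm₁ hm₂, hE]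
    have hmap : (M - M').map shift = M.map shift - M'.map shift := by
      ext1 i j
      exact shift_sub _ _
    rw [hmap, sub_mul, mul_sub, h.equation, h'.equation]
  obtain ⟨N, hM, hN⟩ := h.form
  obtain ⟨N', hM', hN'⟩ := h'.form
  have hq := q_pos hm₁ hm₂ ha hal
  have hcoeff : ∀ i j, ∀ r ≤ 0, ((M - M') i j).coeff r = 0 := by
    intro i j r hr
    have h1 : (M - M') i j = zPow (1 - q m₁ m₂ a) * ofLaurent (N i j - N' i j) := by
      rw [map_sub, mul_sub, hM, hM']
      rfl
    rw [h1, coeff_zPow_mul]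
    by_cases hn : ∃ n : ℤ, (n : ℚ) = r + (1 - q m₁ m₂ a)
    · obtain ⟨n, hn⟩ := hn
      have hn1 : (n : ℚ) < 1 := by linarith
      have hn2 : n < 1 := by exact_mod_cast hn1
      rw [← hn, coeff_ofLaurent_intCast, HahnSeries.coeff_sub, hN i j n (by lia),
        hN' i j n (by lia), sub_self]
    · push Not at hn
      exact coeff_ofLaurent_of_notMem _ hn
  have hz : ∀ i j, (i, j) ∈ window m₁ m₂ → E i j = 0 := by
    refine fun i j hij => hU.eq_zero hm₁ hm₂ (fun i j hij r hr => ?_) hij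
    rw [mem_window] at hij
    rcases lt_or_ge 0 j with hj | hj
    · have := hcoeff ⟨(i - 1).toNat, by lia⟩ ⟨(j - 1).toNat, by lia⟩ r hr
      rw [← hE, foldMatrix_of_le _ _ (by simp only; lia)] at this
      simp only at this
      rwa [show (((j - 1).toNat : ℕ) : ℤ) + 1 = j by lia,
        show (((i - 1).toNat : ℕ) : ℤ) + 1 = i by lia] at this
    · have := hcoeff ⟨(i - 1).toNat, by lia⟩ ⟨(j + m₁ + m₂ - 1).toNat, by lia⟩ r hr
      rw [← hE, foldMatrix_of_lt _ _ (by simp only; lia), HahnSeries.coeff_neg, neg_eq_zero] at this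
      simp only at this
      rwa [show (((j + m₁ + m₂ - 1).toNat : ℕ) : ℤ) + 1 - m₁ - m₂ = j by lia,
        show (((i - 1).toNat : ℕ) : ℤ) + 1 = i by lia] at this
  rw [← sub_eq_zero, ← hE]
  ext1 i j
  have := i.isLt
  have := j.isLt
  rcases le_or_gt ((j : ℕ) + 1) m₁ with hj | hj
  · rw [foldMatrix_of_le _ _ hj, hz _ _ (mem_window.2 (by lia))]
    rfl
  · rw [foldMatrix_of_lt _ _ hj, hz _ _ (mem_window.2 (by lia)), neg_zero]
    rfl

end TDE

end

theorem theorem2 (m₁ m₂ : ℕ) (hm₁ : 1 ≤ m₁) (hm₂ : 1 ≤ m₂)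
    (a : ℕ) (ha : 1 ≤ a) (hal : a ≤ m₁ + m₂ - 1) :
    (∃! M, TDE.IsSolution m₁ m₂ a M) ∧
    ∀ M, TDE.IsSolution m₁ m₂ a M → ∀ i j : Fin (m₁ + m₂),
      M i j =
        if (j : ℕ) + 1 ≤ m₁ then TDE.g m₁ m₂ a (i + 1) (j + 1)
        else -TDE.g m₁ m₂ a (i + 1) ((j : ℤ) + 1 - m₁ - m₂) := by
  have hex := TDE.isSolution_foldMatrix hm₁ hm₂ (a := a) (by lia)
  have huniq := fun M (hM : TDE.IsSolution m₁ m₂ a M) =>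
    hM.unique hm₁ hm₂ ha (by lia) hex
  refine ⟨⟨_, hex, huniq⟩, fun M hM i j => ?_⟩
  rw [huniq M hM]
  rfl
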